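/- Let $n\ge 1$ and write $z=(z',z_n)=x+iy\in\mathbb{C}^n$ with $x,y\in\mathbb{R}^n$ and $y=(y',y_n)$. Put $\rho(z)=y_n-|y'|^2$ and let $T_B=\{z\in\mathbb{C}^n:\rho(z)>0\}$. For $1\le p<\infty$ and $t>-1$ let $L^p_t(T_B)=L^p(T_B,\rho^t\,dV)$, where $dV$ is Lebesgue measure on $\mathbb{C}^n$, and let $A^p_t(T_B)$ be the subspace of holomorphic functions in $L^p_t(T_B)$, with the norm of $L^p_t(T_B)$. Let $$\mathcal{L}_n=\frac{\partial}{\partial z_n},\qquad \mathcal{L}_j=\frac{\partial}{\partial z_j}+2y_j\frac{\partial}{\partial z_n}\quad(1\le j\le n-1),$$ where $\frac{\partial}{\partial z_j}=\frac12\big(\frac{\partial}{\partial x_j}-i\frac{\partial}{\partial y_j}\big)$, and for $\gamma\in\mathbb{N}_0^n$ let $\mathcal{L}^\gamma=\mathcal{L}_1^{\gamma_1}\cdots\mathcal{L}_n^{\gamma_n}$ and $\langle\gamma\rangle=\frac12(\gamma_1+\cdots+\gamma_{n-1})+\gamma_n$. Proposition. Suppose $1\le p<\infty$ and $t>-1$.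 For every $\gamma\in\mathbb{N}_0^n$ the map $f\mapsto\rho^{\langle\gamma\rangle}\mathcal{L}^\gamma f$ is a bounded linear operator from $A^p_t(T_B)$ into $L^p_t(T_B)$. In particular, for every $N\in\mathbb{N}_0$ the map $f\mapsto\mathcal{L}_n^N f=\partial_{z_n}^N f$ is a bounded linear operator from $A^p_t(T_B)$ into $A^p_{t+Np}(T_B)$. -/

import Mathlib

open MeasureTheory
open scoped ENNReal

noncomputable section

namespace TubeDomain

/- Throughout `n = m + 1 ≥ 1`; a point `z = (z', z_n)` of `ℂⁿ` is a function `Fin (m + 1) → ℂ`,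
the last coordinate `z_n` is `z (Fin.last m)` and `z'` is `j ↦ z (Fin.castSucc j)`, `j : Fin m`. -/

/-- The base `B = {y = (y', y_n) ∈ ℝⁿ : |y'|² < y_n}`. -/
def base (m : ℕ) : Set (Fin (m + 1) → ℝ) :=
  {y | ∑ j : Fin m, y j.castSucc ^ 2 < y (Fin.last m)}

/-- The tubular domain `T_B = {x + i y : x ∈ ℝⁿ, y ∈ B}`. -/
def tube (m : ℕ) : Set (Fin (m + 1) → ℂ) :=
  {z | (fun j => (z j).im) ∈ base m}

/-- `ρ(z) = y_n - |y'|²`, where `y = Im z`. -/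
def rho {m : ℕ} (z : Fin (m + 1) → ℂ) : ℝ :=
  (z (Fin.last m)).im - ∑ j : Fin m, (z j.castSucc).im ^ 2

/-- The measure `dV_t = ρ^t dV` on `T_B`, with `dV` the Lebesgue measure of `ℂⁿ`. -/
def weightedVolume (m : ℕ) (t : ℝ) : Measure (Fin (m + 1) → ℂ) :=
  (volume.restrict (tube m)).withDensity fun z => ENNReal.ofReal (rho z ^ t)

/-- The space `L^p_t(T_B)`. -/
abbrev WeightedLp (m : ℕ) (p : ℝ≥0∞) (t : ℝ) : Type :=
  Lp ℂ p (weightedVolume m t)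

/-- The weighted Bergman space `A^p_t(T_B)`: the elements of `L^p_t(T_B)` that are represented by a
holomorphic function on `T_B`, with the norm of `L^p_t(T_B)`. -/
def bergman (m : ℕ) (p : ℝ≥0∞) [Fact (1 ≤ p)] (t : ℝ) : Submodule ℂ (WeightedLp m p t) where
  carrier := {f | ∃ F : (Fin (m + 1) → ℂ) → ℂ,
    DifferentiableOn ℂ F (tube m) ∧ f =ᵐ[weightedVolume m t] F}
  add_mem' := by
    rintro f g ⟨F, hF, hf⟩ ⟨G, hG, hg⟩
    exact ⟨F + G, hF.add hG, (Lp.coeFn_add f g).trans (hf.add hg)⟩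
  zero_mem' := ⟨0, differentiableOn_const 0, Lp.coeFn_zero ℂ p _⟩
  smul_mem' := by
    rintro c f ⟨F, hF, hf⟩
    exact ⟨c • F, hF.const_smul c, (Lp.coeFn_smul c f).trans (hf.const_smul c)⟩

/-- The Wirtinger derivative `∂f/∂z_j = (∂f/∂x_j - i ∂f/∂y_j) / 2`, where `z_j = x_j + i y_j`. -/
def wirtinger {m : ℕ} (j : Fin (m + 1)) (f : (Fin (m + 1) → ℂ) → ℂ) :
    (Fin (m + 1) → ℂ) → ℂ :=
  fun z => (fderiv ℝ f z (Pi.single j 1) - Complex.I * fderiv ℝ f z (Pi.single j Complex.I)) / 2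

/-- The operators `L_n = ∂/∂z_n` and `L_j = ∂/∂z_j + 2 y_j ∂/∂z_n` for `j = 1, …, n - 1`. -/
def opL {m : ℕ} (j : Fin (m + 1)) (f : (Fin (m + 1) → ℂ) → ℂ) : (Fin (m + 1) → ℂ) → ℂ :=
  if j = Fin.last m then wirtinger (Fin.last m) f
  else fun z => wirtinger j f z + 2 * ((z j).im : ℂ) * wirtinger (Fin.last m) f z

/-- The operator `L^γ = (L_1)^{γ_1} ⋯ (L_n)^{γ_n}`. -/
def opLPow {m : ℕ} (γ : Fin (m + 1) → ℕ) :
    ((Fin (m + 1) → ℂ) → ℂ) → ((Fin (m + 1) → ℂ) → ℂ) :=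
  (List.ofFn fun j => (opL j)^[γ j]).foldr (fun S T => S ∘ T) id

/-- `⟨γ⟩ = (γ_1 + ⋯ + γ_{n-1}) / 2 + γ_n`. -/
def bracket {m : ℕ} (γ : Fin (m + 1) → ℕ) : ℝ :=
  (∑ j : Fin m, (γ j.castSucc : ℝ)) / 2 + (γ (Fin.last m) : ℝ)

end TubeDomain

end

/-! The tube is homogeneous. For each `z` in it the affine map `phi z` sends `0` to `z` and
satisfies ρ(φ_z(ζ)) = ρ(z)(1 + ρ(ζ)), and pulling back along it multiplies `L_n` by ρ(z) and the
other `L_j` by ρ(z)^{1/2} (`rho_phi`, `opL_comp_phi`). Hence ρ(z)^⟨γ⟩ L^γ f(z) is exactly L^γ(f ∘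
φ_z)(0), and one estimate at the origin, on a fixed polydisc, serves all points
(`foldr_opL_comp_phi`).

At the origin the obstacle is that `L_j` does not preserve holomorphy, because of its coefficient `2
y_j`. Replacing conj z by an independent variable `w` turns `L_j` into a holomorphic operator on
functions of (z, w), to which Cauchy estimates apply repeatedly. With the sub-mean value property of
|f|^q this bounds |L^γ f(0)|^q by the integral of |f|^q over the polydisc
(`exists_enorm_foldr_opL_zero_le`).

Integrating this bound over z against ρ^t, the change of variables by φ_z and Tonelli give the L^p
bound (`lintegral_tube_lintegral_ball_le`). The images of the polydisc are boxes of volume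
comparable to ρ(z)^{m+2}, on which ρ is comparable to ρ(z), and w lies in the box at z only if z
lies in a dilated box at w, so the powers of ρ balance. Finally, holomorphic representatives are
unique on the tube, so the estimate defines a bounded operator on classes. -/

noncomputable section

namespace TubeDomain

/-! ### Holomorphic functions of several variables are smooth -/

section SeveralVariables

variable {E : Type*} [NormedAddCommGroup E] [NormedSpace ℂ E]

theorem diffContOnCl_slice {U : Set E} (hU : IsOpen U) {f : E → ℂ} (hf : DifferentiableOn ℂ f U)
    {r : ℝ} (hr : 0 < r) {z v : E} (hz : ∀ c : ℂ, ‖c‖ ≤ r → z + c • v ∈ U) :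
    DiffContOnCl ℂ (fun c : ℂ => f (z + c • v)) (Metric.ball 0 r) := by
  have hd : ∀ c : ℂ, ‖c‖ ≤ r → DifferentiableAt ℂ (fun c : ℂ => f (z + c • v)) c := by
    intro c hc
    have h1 : DifferentiableAt ℂ f (z + c • v) :=
      (hf _ (hz c hc)).differentiableAt (hU.mem_nhds (hz c hc))
    exact h1.comp c (by fun_prop)
  refine ⟨fun c hc => (hd c ?_).differentiableWithinAt, ?_⟩
  · simpa using (Metric.mem_ball.1 hc).le
  · rw [closure_ball _ hr.ne']
    exact fun c hc => (hd c (by simpa using hc)).continuousAt.continuousWithinAt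

theorem deriv_slice {f : E → ℂ} {z : E} (hf : DifferentiableAt ℂ f z) (v : E) :
    deriv (fun c : ℂ => f (z + c • v)) 0 = fderiv ℂ f z v := by
  have h2 : HasDerivAt (fun c : ℂ => z + c • v) v 0 := by
    simpa using ((hasDerivAt_id (0 : ℂ)).smul_const v).const_add z
  have h0 : HasFDerivAt f (fderiv ℂ f z) (z + (0 : ℂ) • v) := by simpa using hf.hasFDerivAt
  exact (h0.comp_hasDerivAt (0 : ℂ) h2).deriv

theorem norm_fderiv_apply_le {U : Set E} (hU : IsOpen U) {f : E → ℂ} (hf : DifferentiableOn ℂ f U)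
    {M r : ℝ} (hr : 0 < r) {z v : E} (hz : ∀ c : ℂ, ‖c‖ ≤ r → z + c • v ∈ U)
    (hM : ∀ x ∈ U, ‖f x‖ ≤ M) : ‖fderiv ℂ f z v‖ ≤ M / r := by
  have hzU : z ∈ U := by simpa using hz 0 (by simpa using hr.le)
  rw [← deriv_slice (hf.differentiableAt (hU.mem_nhds hzU)) v]
  exact Complex.norm_deriv_le_of_forall_mem_sphere_norm_le hr (diffContOnCl_slice hU hf hr hz)
    fun c hc => hM _ (hz c (by simpa using hc.le))

theorem fderiv_apply_eq_circleIntegral {U : Set E} (hU : IsOpen U) {f : E → ℂ}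
    (hf : DifferentiableOn ℂ f U) {r : ℝ} (hr : 0 < r) {z v : E}
    (hz : ∀ c : ℂ, ‖c‖ ≤ r → z + c • v ∈ U) :
    fderiv ℂ f z v =
      (2 * Real.pi * Complex.I : ℂ)⁻¹ • ∮ c in C(0, r), ((c - 0) ^ 2)⁻¹ • f (z + c • v) := by
  have hzU : z ∈ U := by simpa using hz 0 (by simpa using hr.le)
  rw [← deriv_slice (hf.differentiableAt (hU.mem_nhds hzU)) v]
  have := (diffContOnCl_slice hU hf hr hz).deriv_eq_smul_circleIntegral hr
  simp only [one_div] at this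
  rw [this, smul_smul, inv_mul_cancel₀ Complex.two_pi_I_ne_zero, one_smul]

/-- The directional derivative is a Cauchy integral over a circle in the complex line through `z`
along `v`. It can be differentiated in `z` under the integral sign, since Cauchy's estimate bounds
`fderiv ℂ f` uniformly near `x₀`. -/
theorem differentiableOn_fderiv_apply [FiniteDimensional ℂ E] {U : Set E} (hU : IsOpen U)
    {f : E → ℂ} (hf : DifferentiableOn ℂ f U) (v : E) :
    DifferentiableOn ℂ (fun z => fderiv ℂ f z v) U := by
  let _ : MeasurableSpace E := borel E
  have : BorelSpace E := ⟨rfl⟩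
  have : ProperSpace E := FiniteDimensional.proper ℂ E
  have : ProperSpace (E →L[ℂ] ℂ) := FiniteDimensional.proper ℂ _
  intro x₀ hx₀
  obtain ⟨δ, hδ, hball⟩ : ∃ δ > 0, Metric.closedBall x₀ δ ⊆ U :=
    Metric.nhds_basis_closedBall.mem_iff.1 (hU.mem_nhds hx₀)
  obtain ⟨M, hM⟩ : ∃ M, ∀ x ∈ Metric.closedBall x₀ δ, ‖f x‖ ≤ M :=
    (isCompact_closedBall x₀ δ).exists_bound_of_continuousOn (hf.continuousOn.mono hball)
  -- Circles of this radius along `v` move a point by at most `δ / 4`; the added `1` allows `v = 0`.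
  set r : ℝ := δ / (4 * (‖v‖ + 1)) with hr_def
  have hv1 : 0 < ‖v‖ + 1 := by positivity
  have hr : 0 < r := by positivity
  have hrv : r * ‖v‖ ≤ δ / 4 := by
    have : r * (‖v‖ + 1) = δ / 4 := by rw [hr_def]; field_simp
    nlinarith
  have hmem : ∀ z ∈ Metric.ball x₀ (δ / 4), ∀ c : ℂ, ‖c‖ ≤ r →
      z + c • v ∈ Metric.ball x₀ (3 * δ / 4) := by
    intro z hz c hc
    rw [mem_ball_iff_norm] at hz ⊢
    have : ‖c • v‖ ≤ r * ‖v‖ := by rw [norm_smul]; gcongr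
    calc ‖z + c • v - x₀‖ = ‖(z - x₀) + c • v‖ := by congr 1; abel
      _ ≤ ‖z - x₀‖ + ‖c • v‖ := norm_add_le _ _
      _ < 3 * δ / 4 := by linarith
  have hsub : Metric.ball x₀ δ ⊆ U := Metric.ball_subset_closedBall.trans hball
  have hbound : ∀ y ∈ Metric.ball x₀ (3 * δ / 4), ‖fderiv ℂ f y‖ ≤ |M| * (8 / δ) := by
    intro y hy
    refine ContinuousLinearMap.opNorm_le_bound _ (by positivity) fun w => ?_
    rcases eq_or_ne w 0 with rfl | hw
    · simp
    have hw' : 0 < ‖w‖ := norm_pos_iff.2 hw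
    have := norm_fderiv_apply_le Metric.isOpen_ball (hf.mono hsub) (M := |M|) (r := δ / 8 / ‖w‖)
      (z := y) (v := w) (by positivity) ?_ ?_
    · refine this.trans (le_of_eq ?_)
      field_simp
    · intro c hc
      rw [mem_ball_iff_norm] at hy ⊢
      have : ‖c • w‖ ≤ δ / 8 := by
        rw [norm_smul]
        calc ‖c‖ * ‖w‖ ≤ δ / 8 / ‖w‖ * ‖w‖ := by gcongr
          _ = δ / 8 := by field_simp
      calc ‖y + c • w - x₀‖ = ‖(y - x₀) + c • w‖ := by congr 1; abel
        _ ≤ ‖y - x₀‖ + ‖c • w‖ := norm_add_le _ _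
        _ < δ := by linarith
    · intro x hx
      exact (hM x (Metric.ball_subset_closedBall hx)).trans (le_abs_self _)
  have hcirc : ∀ θ : ℝ, ‖circleMap 0 r θ‖ ≤ r := fun θ => by simp [abs_of_pos hr]
  have hUd : ∀ y ∈ Metric.ball x₀ (3 * δ / 4), DifferentiableAt ℂ f y := fun y hy =>
    (hf.differentiableAt (hU.mem_nhds (hsub (Metric.ball_subset_ball (by linarith) hy))))
  have hcont : ∀ z ∈ Metric.ball x₀ (δ / 4), Continuous fun θ : ℝ =>
      deriv (circleMap 0 r) θ • ((circleMap 0 r θ - 0) ^ 2)⁻¹ • f (z + circleMap 0 r θ • v) := by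
    intro z hz
    have h1 : Continuous fun θ : ℝ => f (z + circleMap 0 r θ • v) := by
      rw [continuous_iff_continuousAt]
      intro θ
      exact ContinuousAt.comp (f := fun θ : ℝ => z + circleMap 0 r θ • v)
        (hUd _ (hmem z hz _ (hcirc θ))).continuousAt (by fun_prop)
    have h2 : ∀ θ : ℝ, (circleMap 0 r θ - 0) ^ 2 ≠ 0 := fun θ => by
      simp [hr.ne']
    simp only [deriv_circleMap]
    exact (by fun_prop : Continuous fun θ : ℝ => circleMap 0 r θ * Complex.I).smul
      ((Continuous.inv₀ (by fun_prop) h2).smul h1)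
  have key := intervalIntegral.hasFDerivAt_integral_of_dominated_of_fderiv_le (𝕜 := ℂ)
    (μ := volume) (a := 0) (b := 2 * Real.pi) (x₀ := x₀) (s := Metric.ball x₀ (δ / 4))
    (F := fun z θ => deriv (circleMap 0 r) θ • ((circleMap 0 r θ - 0) ^ 2)⁻¹ •
      f (z + circleMap 0 r θ • v))
    (F' := fun z θ => deriv (circleMap 0 r) θ • ((circleMap 0 r θ - 0) ^ 2)⁻¹ •
      fderiv ℂ f (z + circleMap 0 r θ • v))
    (bound := fun _ => r * ((r ^ 2)⁻¹ * (|M| * (8 / δ))))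
    (Metric.ball_mem_nhds _ (by positivity)) ?_ ?_ ?_ ?_ ?_ ?_
  · have heq : (fun z => fderiv ℂ f z v) =ᶠ[nhds x₀] fun z =>
        (2 * Real.pi * Complex.I : ℂ)⁻¹ • ∫ θ in (0:ℝ)..2 * Real.pi,
          deriv (circleMap 0 r) θ • ((circleMap 0 r θ - 0) ^ 2)⁻¹ • f (z + circleMap 0 r θ • v) := by
      filter_upwards [Metric.ball_mem_nhds x₀ (show 0 < δ / 4 by positivity)] with z hz
      exact fderiv_apply_eq_circleIntegral Metric.isOpen_ball (hf.mono hsub) hr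
        fun c hc => Metric.ball_subset_ball (by linarith) (hmem z hz c hc)
    exact ((key.differentiableAt.fun_const_smul _).congr_of_eventuallyEq heq).differentiableWithinAt
  · filter_upwards [Metric.ball_mem_nhds x₀ (show 0 < δ / 4 by positivity)] with z hz
    exact (hcont z hz).aestronglyMeasurable
  · exact (hcont x₀ (Metric.mem_ball_self (by positivity))).intervalIntegrable _ _
  -- Continuity of the derivative is not yet known here, but its measurability holds for any
  -- function.
  · have h1 : Measurable fun θ : ℝ => fderiv ℂ f (x₀ + circleMap 0 r θ • v) :=
      (measurable_fderiv ℂ f).comp (by fun_prop : Continuous fun θ : ℝ =>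
        x₀ + circleMap 0 r θ • v).measurable
    have h2 : Measurable fun θ : ℝ => ((circleMap 0 r θ - 0) ^ 2)⁻¹ :=
      (by fun_prop : Continuous fun θ : ℝ => (circleMap 0 r θ - 0) ^ 2).measurable.inv
    have h3 : Measurable fun θ : ℝ => deriv (circleMap 0 r) θ := by
      simp only [deriv_circleMap]
      exact (by fun_prop : Continuous fun θ : ℝ => circleMap 0 r θ * Complex.I).measurable
    exact (h3.aestronglyMeasurable.smul (h2.aestronglyMeasurable.smul h1.aestronglyMeasurable))
  · refine Filter.Eventually.of_forall fun θ _ z hz => ?_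
    rw [norm_smul, norm_smul]
    have h1 : ‖deriv (circleMap 0 r) θ‖ = r := by simp [deriv_circleMap, abs_of_pos hr]
    have h2 : ‖((circleMap 0 r θ - 0) ^ 2)⁻¹‖ = (r ^ 2)⁻¹ := by simp
    rw [h1, h2]
    gcongr
    exact hbound _ (hmem z hz _ (hcirc θ))
  · exact intervalIntegrable_const
  · refine Filter.Eventually.of_forall fun θ _ z hz => ?_
    have h1 := (hUd _ (hmem z hz _ (hcirc θ))).hasFDerivAt
    have h2 : HasFDerivAt (fun z => f (z + circleMap 0 r θ • v))
        (fderiv ℂ f (z + circleMap 0 r θ • v)) z := by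
      simpa using (hasFDerivAt_comp_add_right (circleMap 0 r θ • v)).2 h1
    exact (h2.fun_const_smul _).fun_const_smul _

theorem contDiffOn_of_differentiableOn [FiniteDimensional ℂ E] {U : Set E} (hU : IsOpen U)
    {f : E → ℂ} (hf : DifferentiableOn ℂ f U) : ContDiffOn ℂ (⊤ : ℕ∞) f U := by
  rw [contDiffOn_infty]
  intro n
  induction n generalizing f with
  | zero => exact contDiffOn_zero.2 hf.continuousOn
  | succ n ih =>
    have : ((n + 1 : ℕ) : WithTop ℕ∞) = (n : WithTop ℕ∞) + 1 := by norm_cast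
    rw [this, contDiffOn_succ_iff_fderiv_of_isOpen hU]
    refine ⟨hf, by simp, ?_⟩
    rw [contDiffOn_clm_apply]
    exact fun y => ih (differentiableOn_fderiv_apply hU hf y)

end SeveralVariables

/-! ### Sub-mean value inequality on polydiscs -/

section MeanValue

variable {ι : Type*} [Fintype ι]

theorem measurePreserving_smul_of_norm_eq_one (a : ℂ) (ha : ‖a‖ = 1) :
    MeasurePreserving (fun x : ι → ℂ => a • x) volume volume := by
  have h : MeasurePreserving (fun w : ℂ => a * w) volume volume := by
    exact (rotation (⟨a, by simp [Submonoid.unitSphere, ha]⟩ : Circle)).measurePreserving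
  exact volume_preserving_pi (fun _ : ι => h)

theorem enorm_le_lintegral_circle {E : Type*} [NormedAddCommGroup E] [NormedSpace ℂ E]
    {f : E → ℂ} {z : E} {r : ℝ} (hf : DifferentiableOn ℂ f (Metric.ball z r)) {x : E}
    (hx : x ∈ Metric.ball (0 : E) r) :
    ENNReal.ofReal (2 * Real.pi) * ‖f z‖ₑ ≤
      ∫⁻ θ in Set.Ioc 0 (2 * Real.pi), ‖f (z + circleMap 0 1 θ • x)‖ₑ := by
  have h1 := diffContOnCl_slice Metric.isOpen_ball hf one_pos (z := z) (v := x) (by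
    intro c hc
    rw [mem_ball_zero_iff] at hx
    rw [mem_ball_iff_norm, add_sub_cancel_left, norm_smul]
    nlinarith [norm_nonneg x, norm_nonneg c])
  have h2 := DiffContOnCl.circleAverage (c := 0) (R := 1) (by simpa using h1)
  rw [Real.circleAverage_def] at h2
  simp only [zero_smul, add_zero] at h2
  rw [← h2, enorm_smul, ← mul_assoc]
  have h3 : ENNReal.ofReal (2 * Real.pi) * ‖(2 * Real.pi)⁻¹‖ₑ = 1 := by
    rw [Real.enorm_eq_ofReal (by positivity), ← ENNReal.ofReal_mul (by positivity),
      mul_inv_cancel₀ (by positivity), ENNReal.ofReal_one]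
  rw [h3, one_mul, intervalIntegral.integral_of_le (by positivity)]
  exact enorm_integral_le_lintegral_enorm _

/-- The common rotation x ↦ e^{iθ}x preserves both volume and the polydisc. Integrating the
one-variable mean value inequality over all `x` in the polydisc and exchanging the integrals
therefore gives the volume average, without polar coordinates. -/
theorem enorm_mul_volume_ball_le {f : (ι → ℂ) → ℂ} {z : ι → ℂ} {r : ℝ}
    (hf : DifferentiableOn ℂ f (Metric.ball z r)) :
    ‖f z‖ₑ * volume (Metric.ball (0 : ι → ℂ) r) ≤ ∫⁻ x in Metric.ball z r, ‖f x‖ₑ := by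
  classical
  set h : (ι → ℂ) → ℝ≥0∞ := (Metric.ball z r).indicator fun x => ‖f x‖ₑ with h_def
  have hh : Measurable h := by
    have : (Metric.ball z r).indicator f = (Metric.ball z r).piecewise f 0 := by
      rw [← Set.piecewise_eq_indicator]
    have h1 : Measurable ((Metric.ball z r).indicator f) := by
      rw [this]
      exact hf.continuousOn.measurable_piecewise continuousOn_const measurableSet_ball
    have h2 : h = fun x => ‖(Metric.ball z r).indicator f x‖ₑ := by
      ext x; by_cases hx : x ∈ Metric.ball z r <;> simp [h_def, hx]
    rw [h2]
    exact h1.enorm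
  have hmem : ∀ (θ : ℝ) (x : ι → ℂ),
      z + circleMap 0 1 θ • x ∈ Metric.ball z r ↔ x ∈ Metric.ball (0 : ι → ℂ) r := by
    intro θ x
    rw [mem_ball_iff_norm, add_sub_cancel_left, norm_smul, mem_ball_zero_iff]
    simp
  have hint : ∫⁻ x in Metric.ball z r, ‖f x‖ₑ = ∫⁻ x, h x := by
    rw [h_def, lintegral_indicator measurableSet_ball]
  have hrot : ∀ θ : ℝ, ∫⁻ x in Metric.ball (0 : ι → ℂ) r, h (z + circleMap 0 1 θ • x) =
      ∫⁻ x, h x := by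
    intro θ
    rw [← lintegral_indicator measurableSet_ball]
    have h1 : (Metric.ball (0 : ι → ℂ) r).indicator (fun x => h (z + circleMap 0 1 θ • x)) =
        fun x => h (z + circleMap 0 1 θ • x) := by
      ext x
      by_cases hx : x ∈ Metric.ball (0 : ι → ℂ) r
      · simp [hx]
      · have := (hmem θ x).not.2 hx
        rw [Set.indicator_of_notMem hx, h_def, Set.indicator_of_notMem this]
    rw [h1, (measurePreserving_smul_of_norm_eq_one (ι := ι) (circleMap 0 1 θ)
      (by simp)).lintegral_comp (f := fun x => h (z + x)) (hh.comp (measurable_const_add z)),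
      lintegral_add_left_eq_self]
  have h2pi : ENNReal.ofReal (2 * Real.pi) ≠ 0 := by simp [Real.pi_pos]
  rw [hint, ← ENNReal.mul_le_mul_iff_right h2pi ENNReal.ofReal_ne_top]
  calc ENNReal.ofReal (2 * Real.pi) * (‖f z‖ₑ * volume (Metric.ball (0 : ι → ℂ) r))
      = ∫⁻ _ in Metric.ball (0 : ι → ℂ) r, ENNReal.ofReal (2 * Real.pi) * ‖f z‖ₑ := by
        rw [setLIntegral_const, mul_assoc]
    _ ≤ ∫⁻ x in Metric.ball (0 : ι → ℂ) r, ∫⁻ θ in Set.Ioc 0 (2 * Real.pi),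
          h (z + circleMap 0 1 θ • x) := by
        refine setLIntegral_mono' measurableSet_ball fun x hx => ?_
        refine (enorm_le_lintegral_circle hf hx).trans (le_of_eq ?_)
        refine lintegral_congr fun θ => ?_
        rw [h_def, Set.indicator_of_mem ((hmem θ x).2 hx)]
    _ = ∫⁻ θ in Set.Ioc 0 (2 * Real.pi), ∫⁻ x in Metric.ball (0 : ι → ℂ) r,
          h (z + circleMap 0 1 θ • x) := by
        refine lintegral_lintegral_swap (Measurable.aemeasurable ?_)
        exact hh.comp (by fun_prop : Continuous fun p : (ι → ℂ) × ℝ =>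
          z + circleMap 0 1 p.2 • p.1).measurable
    _ = ENNReal.ofReal (2 * Real.pi) * ∫⁻ x, h x := by
        simp only [hrot]
        rw [setLIntegral_const, Real.volume_Ioc, sub_zero, mul_comm]

/-- This is the case `q = 1` combined with Hölder's inequality on the ball; the surplus factor
V^{q-1} cancels. -/
theorem enorm_rpow_mul_volume_ball_le {f : (ι → ℂ) → ℂ} {z : ι → ℂ} {r : ℝ} (hr : 0 < r)
    (hf : DifferentiableOn ℂ f (Metric.ball z r)) {q : ℝ} (hq : 1 ≤ q) :
    ‖f z‖ₑ ^ q * volume (Metric.ball (0 : ι → ℂ) r) ≤ ∫⁻ x in Metric.ball z r, ‖f x‖ₑ ^ q := by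
  have hq0 : 0 < q := by linarith
  have h1 := enorm_mul_volume_ball_le hf
  have h2 := eLpNorm'_le_eLpNorm'_mul_rpow_measure_univ (μ := volume.restrict (Metric.ball z r))
    one_pos hq (hf.continuousOn.aestronglyMeasurable measurableSet_ball)
  simp only [eLpNorm'_eq_lintegral_enorm, ENNReal.rpow_one, div_one, Measure.restrict_apply_univ]
    at h2
  have hv : volume (Metric.ball z r) = volume (Metric.ball (0 : ι → ℂ) r) :=
    Measure.addHaar_ball_center volume z r
  rw [hv] at h2
  set V := volume (Metric.ball (0 : ι → ℂ) r)
  have hV0 : V ≠ 0 := (Metric.measure_ball_pos volume _ hr).ne'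
  have hVt : V ≠ ⊤ := measure_ball_lt_top.ne
  have h3 := ENNReal.rpow_le_rpow (h1.trans h2) hq0.le
  rw [ENNReal.mul_rpow_of_nonneg _ _ hq0.le, ENNReal.mul_rpow_of_nonneg _ _ hq0.le,
    ← ENNReal.rpow_mul, ← ENNReal.rpow_mul, one_div, inv_mul_cancel₀ hq0.ne', ENNReal.rpow_one,
    sub_mul, inv_mul_cancel₀ hq0.ne', one_mul] at h3
  have h4 : V ^ q = V * V ^ (q - 1) := by
    nth_rw 1 [← add_sub_cancel 1 q, ENNReal.rpow_add 1 (q - 1) hV0 hVt, ENNReal.rpow_one]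
  rw [h4, ← mul_assoc] at h3
  exact (ENNReal.mul_le_mul_iff_left (ENNReal.rpow_pos (pos_iff_ne_zero.2 hV0) hVt).ne'
    (ENNReal.rpow_ne_top_of_nonneg (by linarith) hVt)).1 h3

end MeanValue

/-! ### The operators L_j and their iterates -/

section Operators

variable {m : ℕ}

theorem mem_tube_iff {z : Fin (m + 1) → ℂ} : z ∈ tube m ↔ 0 < rho z := by
  simp [tube, base, rho]

@[fun_prop]
theorem continuous_rho : Continuous (rho : (Fin (m + 1) → ℂ) → ℝ) := by
  unfold rho
  fun_prop

theorem isOpen_tube : IsOpen (tube m) := by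
  have : tube m = {z | 0 < rho z} := Set.ext fun z => mem_tube_iff
  rw [this]
  exact isOpen_lt continuous_const continuous_rho

theorem opL_last (f : (Fin (m + 1) → ℂ) → ℂ) : opL (Fin.last m) f = wirtinger (Fin.last m) f := by
  simp [opL]

theorem opL_castSucc (j : Fin m) (f : (Fin (m + 1) → ℂ) → ℂ) :
    opL j.castSucc f = fun z => wirtinger j.castSucc f z +
      2 * ((z j.castSucc).im : ℂ) * wirtinger (Fin.last m) f z := by
  simp [opL, (Fin.castSucc_lt_last j).ne]

theorem wirtinger_congr {f g : (Fin (m + 1) → ℂ) → ℂ} {z : Fin (m + 1) → ℂ}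
    (h : f =ᶠ[nhds z] g) (j : Fin (m + 1)) : wirtinger j f z = wirtinger j g z := by
  simp only [wirtinger, h.fderiv_eq]

theorem opL_congr {f g : (Fin (m + 1) → ℂ) → ℂ} {z : Fin (m + 1) → ℂ}
    (h : f =ᶠ[nhds z] g) (j : Fin (m + 1)) : opL j f z = opL j g z := by
  induction j using Fin.lastCases with
  | last => simp only [opL_last, wirtinger_congr h]
  | cast j => simp only [opL_castSucc, wirtinger_congr h]

theorem opL_congr_on {U : Set (Fin (m + 1) → ℂ)} (hU : IsOpen U) {f g : (Fin (m + 1) → ℂ) → ℂ}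
    (h : Set.EqOn f g U) (j : Fin (m + 1)) : Set.EqOn (opL j f) (opL j g) U :=
  fun _ hz => opL_congr (h.eventuallyEq_of_mem (hU.mem_nhds hz)) j

/-- Iterates are treated as words in the `L_j`, in arbitrary order, so that every property follows
by induction on one letter. Equality on an open set is what survives differentiation. -/
theorem foldr_opL_congr_on {U : Set (Fin (m + 1) → ℂ)} (hU : IsOpen U)
    {f g : (Fin (m + 1) → ℂ) → ℂ} (h : Set.EqOn f g U) (l : List (Fin (m + 1))) :
    Set.EqOn (l.foldr opL f) (l.foldr opL g) U := by
  induction l with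
  | nil => exact h
  | cons j l ih => exact opL_congr_on hU ih j

theorem wirtinger_add {f g : (Fin (m + 1) → ℂ) → ℂ} {z : Fin (m + 1) → ℂ}
    (hf : DifferentiableAt ℝ f z) (hg : DifferentiableAt ℝ g z) (j : Fin (m + 1)) :
    wirtinger j (f + g) z = wirtinger j f z + wirtinger j g z := by
  simp only [wirtinger, fderiv_add hf hg, add_apply]
  ring

theorem wirtinger_smul (c : ℂ) {f : (Fin (m + 1) → ℂ) → ℂ} {z : Fin (m + 1) → ℂ}
    (hf : DifferentiableAt ℝ f z) (j : Fin (m + 1)) :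
    wirtinger j (c • f) z = c * wirtinger j f z := by
  simp only [wirtinger, fderiv_const_smul hf, smul_apply, smul_eq_mul]
  ring

theorem opL_add {f g : (Fin (m + 1) → ℂ) → ℂ} {z : Fin (m + 1) → ℂ}
    (hf : DifferentiableAt ℝ f z) (hg : DifferentiableAt ℝ g z) (j : Fin (m + 1)) :
    opL j (f + g) z = opL j f z + opL j g z := by
  induction j using Fin.lastCases with
  | last => simp only [opL_last, wirtinger_add hf hg]
  | cast j => simp only [opL_castSucc, wirtinger_add hf hg]; ring

theorem opL_smul (c : ℂ) {f : (Fin (m + 1) → ℂ) → ℂ} {z : Fin (m + 1) → ℂ}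
    (hf : DifferentiableAt ℝ f z) (j : Fin (m + 1)) :
    opL j (c • f) z = c * opL j f z := by
  induction j using Fin.lastCases with
  | last => simp only [opL_last, wirtinger_smul c hf]
  | cast j => simp only [opL_castSucc, wirtinger_smul c hf]; ring

theorem contDiffOn_wirtinger {U : Set (Fin (m + 1) → ℂ)} (hU : IsOpen U)
    {f : (Fin (m + 1) → ℂ) → ℂ} (hf : ContDiffOn ℝ (⊤ : ℕ∞) f U) (j : Fin (m + 1)) :
    ContDiffOn ℝ (⊤ : ℕ∞) (wirtinger j f) U := by
  have h : ∀ v, ContDiffOn ℝ (⊤ : ℕ∞) (fun z => fderiv ℝ f z v) U := fun v =>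
    (hf.fderiv_of_isOpen hU (by simp)).clm_apply contDiffOn_const
  exact ((h _).sub (contDiffOn_const.mul (h _))).div_const _

theorem contDiffOn_opL {U : Set (Fin (m + 1) → ℂ)} (hU : IsOpen U)
    {f : (Fin (m + 1) → ℂ) → ℂ} (hf : ContDiffOn ℝ (⊤ : ℕ∞) f U) (j : Fin (m + 1)) :
    ContDiffOn ℝ (⊤ : ℕ∞) (opL j f) U := by
  induction j using Fin.lastCases with
  | last => rw [opL_last]; exact contDiffOn_wirtinger hU hf _
  | cast j =>
    rw [opL_castSucc]
    have h1 : ContDiff ℝ (⊤ : ℕ∞) fun z : Fin (m + 1) → ℂ => ((z j.castSucc).im : ℂ) :=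
      (Complex.ofRealCLM.comp (Complex.imCLM.comp
        (ContinuousLinearMap.proj (R := ℝ) (φ := fun _ => ℂ) j.castSucc))).contDiff
    exact (contDiffOn_wirtinger hU hf _).add
      ((contDiffOn_const.mul h1.contDiffOn).mul (contDiffOn_wirtinger hU hf _))

theorem contDiffOn_foldr_opL {U : Set (Fin (m + 1) → ℂ)} (hU : IsOpen U)
    {f : (Fin (m + 1) → ℂ) → ℂ} (hf : ContDiffOn ℝ (⊤ : ℕ∞) f U) (l : List (Fin (m + 1))) :
    ContDiffOn ℝ (⊤ : ℕ∞) (l.foldr opL f) U := by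
  induction l with
  | nil => exact hf
  | cons j l ih => exact contDiffOn_opL hU ih j

theorem differentiableAt_of_contDiffOn {U : Set (Fin (m + 1) → ℂ)} (hU : IsOpen U)
    {f : (Fin (m + 1) → ℂ) → ℂ} (hf : ContDiffOn ℝ (⊤ : ℕ∞) f U) {z : Fin (m + 1) → ℂ}
    (hz : z ∈ U) : DifferentiableAt ℝ f z :=
  (hf.differentiableOn (by simp)).differentiableAt (hU.mem_nhds hz)

theorem contDiffOn_real_of_differentiableOn {U : Set (Fin (m + 1) → ℂ)} (hU : IsOpen U)
    {f : (Fin (m + 1) → ℂ) → ℂ} (hf : DifferentiableOn ℂ f U) :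
    ContDiffOn ℝ (⊤ : ℕ∞) f U :=
  (contDiffOn_of_differentiableOn hU hf).restrict_scalars ℝ

theorem foldr_opL_add {U : Set (Fin (m + 1) → ℂ)} (hU : IsOpen U) {f g : (Fin (m + 1) → ℂ) → ℂ}
    (hf : ContDiffOn ℝ (⊤ : ℕ∞) f U) (hg : ContDiffOn ℝ (⊤ : ℕ∞) g U) (l : List (Fin (m + 1))) :
    Set.EqOn (l.foldr opL (f + g)) (l.foldr opL f + l.foldr opL g) U := by
  induction l with
  | nil => exact fun _ _ => rfl
  | cons j l ih =>
    intro z hz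
    exact (opL_congr_on hU ih j hz).trans
      (opL_add (differentiableAt_of_contDiffOn hU (contDiffOn_foldr_opL hU hf l) hz)
        (differentiableAt_of_contDiffOn hU (contDiffOn_foldr_opL hU hg l) hz) j)

theorem foldr_opL_smul {U : Set (Fin (m + 1) → ℂ)} (hU : IsOpen U) (c : ℂ)
    {f : (Fin (m + 1) → ℂ) → ℂ} (hf : ContDiffOn ℝ (⊤ : ℕ∞) f U) (l : List (Fin (m + 1))) :
    Set.EqOn (l.foldr opL (c • f)) (c • l.foldr opL f) U := by
  induction l with
  | nil => exact fun _ _ => rfl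
  | cons j l ih =>
    intro z hz
    exact (opL_congr_on hU ih j hz).trans
      (opL_smul c (differentiableAt_of_contDiffOn hU (contDiffOn_foldr_opL hU hf l) hz) j)

/-- The homogeneity of `L_j` under the dilations of the tube. -/
def opWeight (j : Fin (m + 1)) : ℝ := if j = Fin.last m then 1 else 1 / 2

/-- The multi-index `γ` written as a list of indices. -/
def indexList (γ : Fin (m + 1) → ℕ) : List (Fin (m + 1)) :=
  (List.finRange (m + 1)).flatMap fun j => List.replicate (γ j) j

theorem foldr_opL_replicate (k : ℕ) (j : Fin (m + 1)) (f : (Fin (m + 1) → ℂ) → ℂ) :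
    (List.replicate k j).foldr opL f = (opL j)^[k] f := by
  induction k with
  | zero => rfl
  | succ k ih => rw [List.replicate_succ, List.foldr_cons, ih, Function.iterate_succ_apply']

theorem opLPow_eq_foldr (γ : Fin (m + 1) → ℕ) (f : (Fin (m + 1) → ℂ) → ℂ) :
    opLPow γ f = (indexList γ).foldr opL f := by
  rw [opLPow, indexList, List.ofFn_eq_map]
  generalize List.finRange (m + 1) = L
  induction L with
  | nil => rfl
  | cons j L ih =>
    rw [List.flatMap_cons, List.foldr_append, ← ih, foldr_opL_replicate]
    rfl

theorem sum_opWeight_indexList (γ : Fin (m + 1) → ℕ) :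
    ((indexList γ).map opWeight).sum = bracket γ := by
  have h : ∀ L : List (Fin (m + 1)),
      ((L.flatMap fun j => List.replicate (γ j) j).map opWeight).sum =
        (L.map fun j => (γ j : ℝ) * opWeight j).sum := by
    intro L
    induction L with
    | nil => rfl
    | cons j L ih => simp [ih]
  rw [indexList, h, ← List.ofFn_eq_map, List.sum_ofFn, Fin.sum_univ_castSucc, bracket,
    Finset.sum_div]
  congr 1
  · refine Finset.sum_congr rfl fun j _ => ?_
    simp [opWeight, (Fin.castSucc_lt_last j).ne, div_eq_mul_inv]
  · simp [opWeight]

end Operators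

/-! ### Polarization and the estimate at the origin -/

section Polarization

variable {m : ℕ}

/-- The operator `L_j` acting on the polarization `H(z, w)` of `H(z, conj z)`: as
`2 y_j = -i (z_j - conj z_j)`, it is a holomorphic differential operator in `z`. -/
def polL (j : Fin (m + 1)) (H : (Fin (m + 1) → ℂ) × (Fin (m + 1) → ℂ) → ℂ) :
    (Fin (m + 1) → ℂ) × (Fin (m + 1) → ℂ) → ℂ := fun p =>
  fderiv ℂ H p (Pi.single j 1, 0) +
    (if j = Fin.last m then 0 else -Complex.I * (p.1 j - p.2 j)) *
      fderiv ℂ H p (Pi.single (Fin.last m) 1, 0)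

theorem differentiableOn_polL {U : Set ((Fin (m + 1) → ℂ) × (Fin (m + 1) → ℂ))} (hU : IsOpen U)
    {H : (Fin (m + 1) → ℂ) × (Fin (m + 1) → ℂ) → ℂ} (hH : DifferentiableOn ℂ H U)
    (j : Fin (m + 1)) : DifferentiableOn ℂ (polL j H) U := by
  refine (differentiableOn_fderiv_apply hU hH _).add
    (DifferentiableOn.mul ?_ (differentiableOn_fderiv_apply hU hH _))
  split_ifs
  · exact differentiableOn_const 0
  · fun_prop

theorem differentiableOn_foldr_polL {U : Set ((Fin (m + 1) → ℂ) × (Fin (m + 1) → ℂ))}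
    (hU : IsOpen U) {H : (Fin (m + 1) → ℂ) × (Fin (m + 1) → ℂ) → ℂ} (hH : DifferentiableOn ℂ H U)
    (l : List (Fin (m + 1))) : DifferentiableOn ℂ (l.foldr polL H) U := by
  induction l with
  | nil => exact hH
  | cons j l ih => exact differentiableOn_polL hU ih j

/-- The second slot is antiholomorphic in `z`, so ∂/∂z_j sees only the first. -/
theorem wirtinger_diag {H : (Fin (m + 1) → ℂ) × (Fin (m + 1) → ℂ) → ℂ} {z : Fin (m + 1) → ℂ}
    (hH : DifferentiableAt ℂ H (z, star z)) (j : Fin (m + 1)) :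
    wirtinger j (fun z => H (z, star z)) z = fderiv ℂ H (z, star z) (Pi.single j 1, 0) := by
  have h1 : HasFDerivAt (fun z : Fin (m + 1) → ℂ => (z, star z))
      ((ContinuousLinearMap.id ℝ (Fin (m + 1) → ℂ)).prod
        ((starL' ℝ : (Fin (m + 1) → ℂ) ≃L[ℝ] (Fin (m + 1) → ℂ)) :
          (Fin (m + 1) → ℂ) →L[ℝ] (Fin (m + 1) → ℂ))) z :=
    (hasFDerivAt_id z).prodMk (starL' ℝ : (Fin (m + 1) → ℂ) ≃L[ℝ] (Fin (m + 1) → ℂ)).hasFDerivAt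
  have h2 := ((hH.hasFDerivAt.restrictScalars ℝ).comp z h1).fderiv
  have h3 : ∀ v, fderiv ℝ (fun z => H (z, star z)) z v = fderiv ℂ H (z, star z) (v, star v) := by
    intro v
    exact congrArg (fun A => A v) h2
  simp only [wirtinger, h3]
  set D := fderiv ℂ H (z, star z)
  -- Both real directions are split into their parts in the two slots. Conjugation turns `I` into
  -- `-I` in the second, so those contributions cancel in the Wirtinger combination.
  have e1 : ((Pi.single j 1 : Fin (m + 1) → ℂ), star (Pi.single j 1 : Fin (m + 1) → ℂ)) =
      ((Pi.single j 1 : Fin (m + 1) → ℂ), (0 : Fin (m + 1) → ℂ)) +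
        ((0 : Fin (m + 1) → ℂ), (Pi.single j 1 : Fin (m + 1) → ℂ)) := by
    rw [Pi.star_single]; simp
  have e2 : ((Pi.single j Complex.I : Fin (m + 1) → ℂ),
      star (Pi.single j Complex.I : Fin (m + 1) → ℂ)) =
      Complex.I • ((Pi.single j 1 : Fin (m + 1) → ℂ), (0 : Fin (m + 1) → ℂ)) +
        (-Complex.I) • ((0 : Fin (m + 1) → ℂ), (Pi.single j 1 : Fin (m + 1) → ℂ)) := by
    rw [Pi.star_single]
    ext k <;> by_cases hk : k = j <;> simp [hk]
  rw [e1, e2, map_add, map_add, map_smul, map_smul, smul_eq_mul, smul_eq_mul]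
  linear_combination (-(1 / 2) * D (Pi.single j 1, 0) + 1 / 2 * D (0, Pi.single j 1)) *
    Complex.I_sq

theorem opL_diag {H : (Fin (m + 1) → ℂ) × (Fin (m + 1) → ℂ) → ℂ} {z : Fin (m + 1) → ℂ}
    (hH : DifferentiableAt ℂ H (z, star z)) (j : Fin (m + 1)) :
    opL j (fun z => H (z, star z)) z = polL j H (z, star z) := by
  induction j using Fin.lastCases with
  | last => simp [opL_last, polL, wirtinger_diag hH]
  | cast j =>
    have h : 2 * ((z j.castSucc).im : ℂ) = -Complex.I * (z j.castSucc - star (z j.castSucc)) := by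
      apply Complex.ext <;> simp
      ring
    simp [opL_castSucc, polL, wirtinger_diag hH, (Fin.castSucc_lt_last j).ne, h]

theorem foldr_opL_diag {U : Set ((Fin (m + 1) → ℂ) × (Fin (m + 1) → ℂ))} (hU : IsOpen U)
    {V : Set (Fin (m + 1) → ℂ)} (hV : IsOpen V) (hVU : ∀ z ∈ V, (z, star z) ∈ U)
    {H : (Fin (m + 1) → ℂ) × (Fin (m + 1) → ℂ) → ℂ} (hH : DifferentiableOn ℂ H U)
    (l : List (Fin (m + 1))) :
    Set.EqOn (l.foldr opL fun z => H (z, star z)) (fun z => l.foldr polL H (z, star z)) V := by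
  induction l with
  | nil => exact fun _ _ => rfl
  | cons j l ih =>
    intro z hz
    exact (opL_congr_on hV ih j hz).trans
      (opL_diag ((differentiableOn_foldr_polL hU hH l).differentiableAt
        (hU.mem_nhds (hVU z hz))) j)

/-- `polL` differentiates only in the first variable, so only the first radius shrinks. The constant
is 3 = 1 + 2, as the coefficient z_j - w_j has modulus at most 2. -/
theorem norm_polL_le {R R' : ℝ} (hR : R ≤ 1) (hRR : R' < R)
    {H : (Fin (m + 1) → ℂ) × (Fin (m + 1) → ℂ) → ℂ}
    (hH : DifferentiableOn ℂ H (Metric.ball 0 R ×ˢ Metric.ball 0 1)) {M : ℝ}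
    (hM : ∀ p ∈ Metric.ball 0 R ×ˢ Metric.ball 0 1, ‖H p‖ ≤ M) (j : Fin (m + 1)) :
    ∀ p ∈ Metric.ball 0 R' ×ˢ Metric.ball 0 1, ‖polL j H p‖ ≤ 3 / (R - R') * M := by
  rintro ⟨z, w⟩ ⟨hz, hw⟩
  simp only [mem_ball_zero_iff] at hz hw
  have hr : 0 < R - R' := by linarith
  have key : ∀ k : Fin (m + 1), ‖fderiv ℂ H (z, w) (Pi.single k 1, 0)‖ ≤ M / (R - R') := by
    intro k
    refine norm_fderiv_apply_le (Metric.isOpen_ball.prod Metric.isOpen_ball) hH hr ?_ hM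
    intro c hc
    refine ⟨?_, by simpa using hw⟩
    simp only [mem_ball_zero_iff, Prod.fst_add, Prod.smul_fst]
    have h1 : ‖c • (Pi.single k 1 : Fin (m + 1) → ℂ)‖ ≤ R - R' := by
      rw [norm_smul, Pi.norm_single, norm_one, mul_one]
      exact hc
    linarith [norm_add_le z (c • (Pi.single k 1 : Fin (m + 1) → ℂ))]
  have hc : ‖(if j = Fin.last m then 0 else -Complex.I * (z j - w j) : ℂ)‖ ≤ 2 := by
    split_ifs
    · simp
    · rw [norm_mul, norm_neg, Complex.norm_I, one_mul]
      linarith [norm_sub_le (z j) (w j), norm_le_pi_norm z j, norm_le_pi_norm w j]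
  calc ‖polL j H (z, w)‖ ≤ M / (R - R') + 2 * (M / (R - R')) := by
        refine (norm_add_le _ _).trans (add_le_add (key j) ?_)
        rw [norm_mul]
        exact mul_le_mul hc (key _) (norm_nonneg _) (by norm_num)
    _ = 3 / (R - R') * M := by ring

theorem exists_norm_foldr_polL_le {R : ℝ} (hR : R ≤ 1) (l : List (Fin (m + 1))) {R' : ℝ}
    (hRR : R' < R) : ∃ C : ℝ, ∀ (H : (Fin (m + 1) → ℂ) × (Fin (m + 1) → ℂ) → ℂ) (M : ℝ),
      DifferentiableOn ℂ H (Metric.ball 0 R ×ˢ Metric.ball 0 1) →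
      (∀ p ∈ Metric.ball 0 R ×ˢ Metric.ball 0 1, ‖H p‖ ≤ M) →
      ∀ p ∈ Metric.ball 0 R' ×ˢ Metric.ball 0 1, ‖l.foldr polL H p‖ ≤ C * M := by
  induction l generalizing R' with
  | nil =>
    refine ⟨1, fun H M _ hM p hp => ?_⟩
    rw [one_mul]
    exact hM p ⟨Metric.ball_subset_ball hRR.le hp.1, hp.2⟩
  | cons j l ih =>
    -- The gap between the radii is halved: one half for the tail of the word, one for its head.
    obtain ⟨C, hC⟩ := ih (R' := (R' + R) / 2) (by linarith)
    refine ⟨3 / ((R' + R) / 2 - R') * C, fun H M hH hM p hp => ?_⟩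
    rw [mul_assoc]
    refine norm_polL_le (by linarith) (by linarith) ?_ (hC H M hH hM) j p hp
    exact (differentiableOn_foldr_polL (Metric.isOpen_ball.prod Metric.isOpen_ball) hH l).mono
      (Set.prod_mono_left (Metric.ball_subset_ball (by linarith)))

/-- The polarization used is H(z, w) = f(z); dependence on `w` enters only through the coefficients
of `polL`. -/
theorem exists_norm_foldr_opL_zero_le {R : ℝ} (hR0 : 0 < R) (hR : R ≤ 1)
    (l : List (Fin (m + 1))) : ∃ C : ℝ, 0 ≤ C ∧ ∀ (f : (Fin (m + 1) → ℂ) → ℂ) (M : ℝ), 0 ≤ M →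
      DifferentiableOn ℂ f (Metric.ball 0 R) → (∀ z ∈ Metric.ball 0 R, ‖f z‖ ≤ M) →
      ‖l.foldr opL f 0‖ ≤ C * M := by
  obtain ⟨C, hC⟩ := exists_norm_foldr_polL_le hR l (half_lt_self hR0)
  refine ⟨max C 0, le_max_right _ _, fun f M hM0 hf hM => ?_⟩
  have hH : DifferentiableOn ℂ (fun p : (Fin (m + 1) → ℂ) × (Fin (m + 1) → ℂ) => f p.1)
      (Metric.ball 0 R ×ˢ Metric.ball 0 1) :=
    hf.comp differentiableOn_fst fun p hp => hp.1
  have h1 := foldr_opL_diag (Metric.isOpen_ball.prod Metric.isOpen_ball)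
    (V := Metric.ball 0 R) Metric.isOpen_ball (fun z hz => ⟨hz, by
      rw [mem_ball_zero_iff] at hz ⊢
      rw [norm_star]
      linarith⟩) hH l (Metric.mem_ball_self hR0)
  simp only at h1
  rw [h1]
  refine (hC _ M hH (fun p hp => hM _ hp.1) _ ⟨Metric.mem_ball_self (by linarith), ?_⟩).trans
    (mul_le_mul_of_nonneg_right (le_max_left _ _) hM0)
  simp

theorem exists_enorm_foldr_opL_zero_le {R : ℝ} (hR0 : 0 < R) (hR : R ≤ 1)
    (l : List (Fin (m + 1))) {q : ℝ} (hq : 1 ≤ q) :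
    ∃ C : ℝ≥0∞, C ≠ ⊤ ∧ ∀ f : (Fin (m + 1) → ℂ) → ℂ, DifferentiableOn ℂ f (Metric.ball 0 R) →
      ‖l.foldr opL f 0‖ₑ ^ q ≤ C * ∫⁻ z in Metric.ball 0 R, ‖f z‖ₑ ^ q := by
  obtain ⟨C, hC0, hC⟩ := exists_norm_foldr_opL_zero_le (half_pos hR0) (by linarith) l
  have hq0 : 0 < q := by linarith
  set V := volume (Metric.ball (0 : Fin (m + 1) → ℂ) (R / 2))
  have hV0 : V ≠ 0 := (Metric.measure_ball_pos volume _ (half_pos hR0)).ne'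
  have hVt : V ≠ ⊤ := measure_ball_lt_top.ne
  -- `C + 1` rather than `C` keeps the constant nonzero, so the bound is trivial when the integral
  -- is infinite.
  refine ⟨ENNReal.ofReal (C + 1) ^ q * V⁻¹, ENNReal.mul_ne_top
    (ENNReal.rpow_ne_top_of_nonneg hq0.le ENNReal.ofReal_ne_top) (ENNReal.inv_ne_top.2 hV0),
    fun f hf => ?_⟩
  set A := ∫⁻ z in Metric.ball (0 : Fin (m + 1) → ℂ) R, ‖f z‖ₑ ^ q
  by_cases hA : A = ⊤
  · rw [hA, ENNReal.mul_top]
    · exact le_top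
    · refine mul_ne_zero (ENNReal.rpow_pos ?_ ENNReal.ofReal_ne_top).ne' (ENNReal.inv_ne_zero.2 hVt)
      exact ENNReal.ofReal_pos.2 (by linarith)
  have hsub : ∀ z ∈ Metric.ball (0 : Fin (m + 1) → ℂ) (R / 2),
      Metric.ball z (R / 2) ⊆ Metric.ball (0 : Fin (m + 1) → ℂ) R := by
    intro z hz
    refine Metric.ball_subset_ball' ?_
    linarith [Metric.mem_ball.1 hz]
  have hAV : A * V⁻¹ ≠ ⊤ := ENNReal.mul_ne_top hA (ENNReal.inv_ne_top.2 hV0)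
  have hpt : ∀ z ∈ Metric.ball (0 : Fin (m + 1) → ℂ) (R / 2), ‖f z‖ₑ ≤ (A * V⁻¹) ^ (1 / q) := by
    intro z hz
    have h1 := (enorm_rpow_mul_volume_ball_le (half_pos hR0) (hf.mono (hsub z hz)) hq).trans
      (lintegral_mono_set (hsub z hz))
    rw [one_div, ENNReal.le_rpow_inv_iff hq0, ← div_eq_mul_inv]
    exact ENNReal.le_div_iff_mul_le (Or.inl hV0) (Or.inl hVt) |>.2 h1
  have hMt : (A * V⁻¹) ^ (1 / q) ≠ ⊤ := ENNReal.rpow_ne_top_of_nonneg (by positivity) hAV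
  have h2 := hC f ((A * V⁻¹) ^ (1 / q)).toReal ENNReal.toReal_nonneg
    (hf.mono (Metric.ball_subset_ball (by linarith))) (fun z hz => by
      rw [← toReal_enorm]
      exact ENNReal.toReal_mono hMt (hpt z hz))
  have h3 : ‖l.foldr opL f 0‖ₑ ≤ ENNReal.ofReal (C + 1) * (A * V⁻¹) ^ (1 / q) := by
    rw [← ofReal_norm]
    refine (ENNReal.ofReal_le_ofReal h2).trans ?_
    rw [ENNReal.ofReal_mul hC0, ENNReal.ofReal_toReal hMt]
    gcongr
    linarith
  calc ‖l.foldr opL f 0‖ₑ ^ q ≤ (ENNReal.ofReal (C + 1) * (A * V⁻¹) ^ (1 / q)) ^ q :=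
        ENNReal.rpow_le_rpow h3 hq0.le
    _ = ENNReal.ofReal (C + 1) ^ q * V⁻¹ * A := by
        rw [ENNReal.mul_rpow_of_nonneg _ _ hq0.le, ← ENNReal.rpow_mul, one_div,
          inv_mul_cancel₀ hq0.ne', ENNReal.rpow_one]
        ring

end Polarization

/-! ### Affine automorphisms and their boxes -/

section Automorphisms

variable {m : ℕ}

/-- The matrix of the linear part of the affine automorphism of the tube that moves `i e_n` to
a translate of `z`. -/
def frame (z : Fin (m + 1) → ℂ) : Matrix (Fin (m + 1)) (Fin (m + 1)) ℂ := fun j k =>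
  if j = Fin.last m then
    if k = Fin.last m then (rho z : ℂ) else (2 * √(rho z) * (z k).im : ℝ)
  else if k = j then (√(rho z) : ℂ) else 0

/-- The affine map `ζ ↦ (z' + √ρ ζ', z_n + ρ ζ_n + 2 √ρ y'·ζ')`, where `ρ = ρ(z)`. -/
def phi (z ζ : Fin (m + 1) → ℂ) : Fin (m + 1) → ℂ := z + Matrix.mulVec (frame z) ζ

theorem phi_castSucc (z ζ : Fin (m + 1) → ℂ) (k : Fin m) :
    phi z ζ k.castSucc = z k.castSucc + √(rho z) * ζ k.castSucc := by
  simp [phi, frame, Matrix.mulVec, dotProduct, (Fin.castSucc_lt_last k).ne]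

theorem phi_last (z ζ : Fin (m + 1) → ℂ) :
    phi z ζ (Fin.last m) = z (Fin.last m) + rho z * ζ (Fin.last m) +
      2 * √(rho z) * ∑ k : Fin m, (z k.castSucc).im * ζ k.castSucc := by
  simp only [phi, frame, Matrix.mulVec, dotProduct, Fin.sum_univ_castSucc, Pi.add_apply, if_true,
    (Fin.castSucc_lt_last _).ne, if_false, Finset.mul_sum]
  rw [add_assoc, add_comm (_ * _)]
  congr 2
  refine Finset.sum_congr rfl fun k _ => ?_
  push_cast
  ring

theorem phi_zero (z : Fin (m + 1) → ℂ) : phi z 0 = z := by simp [phi]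

/-- The shear term 2√ρ y'·ζ' in the last coordinate is chosen to cancel the cross term in |y' + √ρ
Im ζ'|². -/
theorem rho_phi {z : Fin (m + 1) → ℂ} (hz : z ∈ tube m) (ζ : Fin (m + 1) → ℂ) :
    rho (phi z ζ) = rho z * (1 + rho ζ) := by
  have h0 : √(rho z) ^ 2 = rho z := Real.sq_sqrt (mem_tube_iff.1 hz).le
  have h1 : ∀ k : Fin m, (phi z ζ k.castSucc).im ^ 2 = (z k.castSucc).im ^ 2 +
      2 * √(rho z) * ((z k.castSucc).im * (ζ k.castSucc).im) + rho z * (ζ k.castSucc).im ^ 2 := by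
    intro k
    rw [phi_castSucc]
    simp only [Complex.add_im, Complex.im_ofReal_mul]
    linear_combination (ζ k.castSucc).im ^ 2 * h0
  have h2 : (phi z ζ (Fin.last m)).im = (z (Fin.last m)).im + rho z * (ζ (Fin.last m)).im +
      2 * √(rho z) * ∑ k : Fin m, (z k.castSucc).im * (ζ k.castSucc).im := by
    rw [phi_last, show (2 * (√(rho z) : ℂ)) = ((2 * √(rho z) : ℝ) : ℂ) by push_cast; ring]
    simp only [Complex.add_im, Complex.im_ofReal_mul, Complex.im_sum]
  have h3 : rho (phi z ζ) = (phi z ζ (Fin.last m)).im - ∑ k : Fin m, (phi z ζ k.castSucc).im ^ 2 :=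
    rfl
  rw [h3, h2, Finset.sum_congr rfl fun k _ => h1 k, Finset.sum_add_distrib, Finset.sum_add_distrib,
    ← Finset.mul_sum, ← Finset.mul_sum]
  have h4 : rho z = (z (Fin.last m)).im - ∑ k : Fin m, (z k.castSucc).im ^ 2 := rfl
  have h5 : rho ζ = (ζ (Fin.last m)).im - ∑ k : Fin m, (ζ k.castSucc).im ^ 2 := rfl
  rw [h5]
  linear_combination -h4

theorem hasFDerivAt_phi (z ζ : Fin (m + 1) → ℂ) :
    HasFDerivAt (phi z) (Matrix.toLin' (frame z)).toContinuousLinearMap ζ := by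
  have : phi z = fun ζ => z + (Matrix.toLin' (frame z)).toContinuousLinearMap ζ := by
    ext ζ; simp [phi]
  rw [this]
  exact ((Matrix.toLin' (frame z)).toContinuousLinearMap.hasFDerivAt).const_add z

theorem frame_mulVec_single_last (z : Fin (m + 1) → ℂ) (c : ℂ) :
    Matrix.toLin' (frame z) (Pi.single (Fin.last m) c) = rho z • Pi.single (Fin.last m) c := by
  ext j
  by_cases hj : j = Fin.last m
  · simp [frame, hj]
  · simp [frame, hj, Ne.symm hj]

theorem frame_mulVec_single_castSucc (z : Fin (m + 1) → ℂ) (k : Fin m) (c : ℂ) :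
    Matrix.toLin' (frame z) (Pi.single k.castSucc c) =
      √(rho z) • (Pi.single k.castSucc c : Fin (m + 1) → ℂ) +
        (2 * √(rho z) * (z k.castSucc).im) • (Pi.single (Fin.last m) c : Fin (m + 1) → ℂ) := by
  ext j
  by_cases hj : j = Fin.last m
  · simp [frame, hj, (Fin.castSucc_lt_last k).ne]
  · by_cases hk : k.castSucc = j
    · simp [frame, hj, hk]
    · simp [frame, hj, hk, Ne.symm hk]

theorem fderiv_comp_phi {f : (Fin (m + 1) → ℂ) → ℂ} {z ζ : Fin (m + 1) → ℂ}
    (hf : DifferentiableAt ℝ f (phi z ζ)) (v : Fin (m + 1) → ℂ) :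
    fderiv ℝ (fun ζ => f (phi z ζ)) ζ v = fderiv ℝ f (phi z ζ) (Matrix.toLin' (frame z) v) :=
  congrArg (fun A => A v)
    (hf.hasFDerivAt.comp ζ ((hasFDerivAt_phi z ζ).restrictScalars ℝ)).fderiv

/-- By the chain rule ∂_k becomes √ρ(∂_k + 2 Im z_k ∂_n), and 2 Im ζ_k ∂_n becomes √ρ · 2√ρ Im ζ_k
∂_n. The coefficients add up to twice the imaginary part of the k-th coordinate of φ_z(ζ), which is
the one `L_k` requires at the image point. -/
theorem opL_comp_phi {f : (Fin (m + 1) → ℂ) → ℂ} {z ζ : Fin (m + 1) → ℂ} (hz : z ∈ tube m)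
    (hf : DifferentiableAt ℝ f (phi z ζ)) (j : Fin (m + 1)) :
    opL j (fun ζ => f (phi z ζ)) ζ = ((rho z ^ opWeight j : ℝ) : ℂ) * opL j f (phi z ζ) := by
  have hlast : wirtinger (Fin.last m) (fun ζ => f (phi z ζ)) ζ =
      rho z * wirtinger (Fin.last m) f (phi z ζ) := by
    simp only [wirtinger, fderiv_comp_phi hf, frame_mulVec_single_last, map_smul,
      Complex.real_smul]
    ring
  induction j using Fin.lastCases with
  | last => simp [opL_last, hlast, opWeight]
  | cast k =>
    have h1 : wirtinger k.castSucc (fun ζ => f (phi z ζ)) ζ =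
        √(rho z) * wirtinger k.castSucc f (phi z ζ) +
          2 * √(rho z) * (z k.castSucc).im * wirtinger (Fin.last m) f (phi z ζ) := by
      simp only [wirtinger, fderiv_comp_phi hf, frame_mulVec_single_castSucc, map_smul, map_add,
        Complex.real_smul]
      push_cast
      ring
    have h2 : rho z ^ opWeight k.castSucc = √(rho z) := by
      simp [opWeight, (Fin.castSucc_lt_last k).ne, Real.sqrt_eq_rpow]
    have h3 : ((rho z : ℝ) : ℂ) = √(rho z) * √(rho z) := by
      rw [← Complex.ofReal_mul, Real.mul_self_sqrt (mem_tube_iff.1 hz).le]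
    simp only [opL_castSucc, hlast, h1, h2]
    rw [phi_castSucc]
    simp only [Complex.add_im, Complex.im_ofReal_mul, Complex.ofReal_add, Complex.ofReal_mul]
    linear_combination 2 * ((ζ k.castSucc).im : ℂ) * wirtinger (Fin.last m) f (phi z ζ) * h3

theorem continuous_phi (z : Fin (m + 1) → ℂ) : Continuous (phi z) :=
  continuous_iff_continuousAt.2 fun ζ => (hasFDerivAt_phi z ζ).continuousAt

theorem foldr_opL_comp_phi {f : (Fin (m + 1) → ℂ) → ℂ} {z : Fin (m + 1) → ℂ} (hz : z ∈ tube m)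
    (hf : ContDiffOn ℝ (⊤ : ℕ∞) f (tube m)) (l : List (Fin (m + 1))) :
    Set.EqOn (l.foldr opL fun ζ => f (phi z ζ))
      (fun ζ => ((rho z ^ (l.map opWeight).sum : ℝ) : ℂ) * l.foldr opL f (phi z ζ))
      (phi z ⁻¹' tube m) := by
  induction l with
  | nil => intro ζ _; simp
  | cons j l ih =>
    intro ζ hζ
    have hd := differentiableAt_of_contDiffOn isOpen_tube
      (contDiffOn_foldr_opL isOpen_tube hf l) hζ
    refine (opL_congr_on (isOpen_tube.preimage (continuous_phi z)) ih j hζ).trans ?_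
    have hd' : DifferentiableAt ℝ (fun ζ => l.foldr opL f (phi z ζ)) ζ :=
      hd.comp ζ ((hasFDerivAt_phi z ζ).restrictScalars ℝ).differentiableAt
    refine (opL_smul _ hd' j).trans ?_
    rw [opL_comp_phi hz hd, List.map_cons, List.sum_cons, Real.rpow_add (mem_tube_iff.1 hz)]
    simp only [List.foldr_cons, Complex.ofReal_mul]
    ring

theorem det_frame (z : Fin (m + 1) → ℂ) :
    (frame z).det = (√(rho z) : ℂ) ^ m * rho z := by
  rw [Matrix.det_of_isLowerTriangular, Fin.prod_univ_castSucc]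
  · simp [frame, (Fin.castSucc_lt_last _).ne]
  · intro j k hjk
    have h1 : j < k := hjk
    have h2 : j ≠ Fin.last m := (h1.trans_le (Fin.le_last k)).ne
    simp [frame, h2, h1.ne']

/-- The real determinant is the squared modulus of the complex one, ρ^{m/2+1}. -/
theorem det_fderiv_phi {z : Fin (m + 1) → ℂ} (hz : z ∈ tube m) :
    ((Matrix.toLin' (frame z)).toContinuousLinearMap.restrictScalars ℝ).det =
      rho z ^ (m + 2) := by
  have h : ((Matrix.toLin' (frame z)).toContinuousLinearMap.restrictScalars ℝ).det =
      LinearMap.det ((Matrix.toLin' (frame z)).restrictScalars ℝ) := rfl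
  rw [h, LinearMap.det_restrictScalars, LinearMap.det_toLin', Algebra.norm_complex_apply, det_frame]
  simp only [map_mul, map_pow, Complex.normSq_ofReal,
    Real.mul_self_sqrt (mem_tube_iff.1 hz).le]
  ring

theorem phi_injective {z : Fin (m + 1) → ℂ} (hz : z ∈ tube m) : Function.Injective (phi z) := by
  have hs : ((√(rho z) : ℝ) : ℂ) ≠ 0 := by
    exact_mod_cast (Real.sqrt_pos.2 (mem_tube_iff.1 hz)).ne'
  have hρ : ((rho z : ℝ) : ℂ) ≠ 0 := by exact_mod_cast (mem_tube_iff.1 hz).ne'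
  intro ζ ξ h
  have h1 : ∀ k : Fin m, ζ k.castSucc = ξ k.castSucc := by
    intro k
    have := congrFun h k.castSucc
    rw [phi_castSucc, phi_castSucc] at this
    exact mul_left_cancel₀ hs (add_left_cancel this)
  have h2 := congrFun h (Fin.last m)
  rw [phi_last, phi_last] at h2
  simp only [h1] at h2
  ext j
  induction j using Fin.lastCases with
  | last => exact mul_left_cancel₀ hρ (add_left_cancel (add_right_cancel h2))
  | cast k => exact h1 k

theorem lintegral_image_phi {z : Fin (m + 1) → ℂ} (hz : z ∈ tube m) {s : Set (Fin (m + 1) → ℂ)}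
    (hs : MeasurableSet s) (g : (Fin (m + 1) → ℂ) → ℝ≥0∞) :
    ∫⁻ w in phi z '' s, g w = ENNReal.ofReal (rho z ^ (m + 2)) * ∫⁻ ζ in s, g (phi z ζ) := by
  rw [lintegral_image_eq_lintegral_abs_det_fderiv_mul volume hs
    (fun ζ _ => ((hasFDerivAt_phi z ζ).restrictScalars ℝ).hasFDerivWithinAt)
    (phi_injective hz).injOn, det_fderiv_phi hz, abs_of_pos (pow_pos (mem_tube_iff.1 hz) _),
    lintegral_const_mul' _ _ ENNReal.ofReal_ne_top]

/-- The image of the polydisc of radius `R` under `phi z`. -/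
def box (R : ℝ) (z : Fin (m + 1) → ℂ) : Set (Fin (m + 1) → ℂ) :=
  {w | (∀ k : Fin m, ‖w k.castSucc - z k.castSucc‖ < R * √(rho z)) ∧
    ‖w (Fin.last m) - z (Fin.last m) -
      2 * ∑ k : Fin m, (z k.castSucc).im * (w k.castSucc - z k.castSucc)‖ < R * rho z}

theorem image_phi_ball {z : Fin (m + 1) → ℂ} (hz : z ∈ tube m) {R : ℝ} (hR : 0 < R) :
    phi z '' Metric.ball 0 R = box R z := by
  have hρ := mem_tube_iff.1 hz
  have hs := Real.sqrt_pos.2 hρ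
  have hsc : ((√(rho z) : ℝ) : ℂ) ≠ 0 := by exact_mod_cast hs.ne'
  have hρc : ((rho z : ℝ) : ℂ) ≠ 0 := by exact_mod_cast hρ.ne'
  have hmem : ∀ ζ : Fin (m + 1) → ℂ, ζ ∈ Metric.ball 0 R ↔ phi z ζ ∈ box R z := by
    intro ζ
    have h1 : ∀ k : Fin m, phi z ζ k.castSucc - z k.castSucc = √(rho z) * ζ k.castSucc := by
      intro k; rw [phi_castSucc]; ring
    have h2 : phi z ζ (Fin.last m) - z (Fin.last m) -
        2 * ∑ k : Fin m, (z k.castSucc).im * (√(rho z) * ζ k.castSucc) =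
          rho z * ζ (Fin.last m) := by
      have : ∑ k : Fin m, ((z k.castSucc).im : ℂ) * (√(rho z) * ζ k.castSucc) =
          √(rho z) * ∑ k : Fin m, (z k.castSucc).im * ζ k.castSucc := by
        rw [Finset.mul_sum]
        exact Finset.sum_congr rfl fun k _ => by ring
      rw [this, phi_last]
      ring
    simp only [box, Set.mem_ofPred_eq, h1, h2, norm_mul, Complex.norm_real, Real.norm_eq_abs,
      abs_of_pos hs, abs_of_pos hρ, mem_ball_zero_iff, pi_norm_lt_iff hR]
    rw [Fin.forall_fin_succ']
    simp only [mul_comm R, mul_lt_mul_iff_right₀ hs, mul_lt_mul_iff_right₀ hρ]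
  ext w
  constructor
  · rintro ⟨ζ, hζ, rfl⟩
    exact (hmem ζ).1 hζ
  · intro hw
    obtain ⟨ζ, rfl⟩ : ∃ ζ, phi z ζ = w := by
      refine ⟨Fin.snoc (fun k : Fin m => (w k.castSucc - z k.castSucc) / √(rho z))
        ((w (Fin.last m) - z (Fin.last m) - 2 * ∑ k : Fin m, (z k.castSucc).im *
          (w k.castSucc - z k.castSucc)) / rho z), ?_⟩
      ext j
      induction j using Fin.lastCases with
      | last =>
        rw [phi_last]
        simp only [Fin.snoc_last, Fin.snoc_castSucc]
        have : ∑ k : Fin m, ((z k.castSucc).im : ℂ) * (w k.castSucc - z k.castSucc) =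
          √(rho z) * ∑ k : Fin m, (z k.castSucc).im * ((w k.castSucc - z k.castSucc) / √(rho z)) := by
          rw [Finset.mul_sum]
          exact Finset.sum_congr rfl fun k _ => by field_simp
        rw [this]
        field_simp
        ring
      | cast k =>
        rw [phi_castSucc, Fin.snoc_castSucc]
        field_simp
        ring
    exact ⟨ζ, (hmem ζ).2 hw, rfl⟩

/-- Joint measurability is needed for Tonelli; the explicit inequalities defining `box` make the
graph open. -/
theorem measurableSet_box_graph (R : ℝ) :
    MeasurableSet {p : (Fin (m + 1) → ℂ) × (Fin (m + 1) → ℂ) | p.1 ∈ box R p.2} := by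
  have h1 : IsOpen {p : (Fin (m + 1) → ℂ) × (Fin (m + 1) → ℂ) |
      ∀ k : Fin m, ‖p.1 k.castSucc - p.2 k.castSucc‖ < R * √(rho p.2)} := by
    rw [Set.ofPred_forall]
    exact isOpen_iInter_of_finite fun k => isOpen_lt (by fun_prop) (by fun_prop)
  have h2 : IsOpen {p : (Fin (m + 1) → ℂ) × (Fin (m + 1) → ℂ) |
      ‖p.1 (Fin.last m) - p.2 (Fin.last m) - 2 * ∑ k : Fin m,
        (p.2 k.castSucc).im * (p.1 k.castSucc - p.2 k.castSucc)‖ < R * rho p.2} :=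
    isOpen_lt (by fun_prop) (by fun_prop)
  exact (h1.inter h2).measurableSet

theorem volume_box {z : Fin (m + 1) → ℂ} (hz : z ∈ tube m) {R : ℝ} (hR : 0 < R) :
    volume (box R z) = ENNReal.ofReal (rho z ^ (m + 2)) *
      volume (Metric.ball (0 : Fin (m + 1) → ℂ) R) := by
  have := lintegral_image_phi hz (measurableSet_ball (x := (0 : Fin (m + 1) → ℂ)) (ε := R))
    fun _ => 1
  simpa [image_phi_ball hz hR] using this

end Automorphisms

/-! ### The weighted integral estimate -/

section Estimate

variable {m : ℕ}

/-- For r = 1/(m+2) one has r + m r² = 2r(1 - r) ≤ 1/2, which keeps 1 + ρ(ζ) between 1/2 and 3/2. -/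
theorem abs_rho_le_of_mem_ball {ζ : Fin (m + 1) → ℂ}
    (hζ : ζ ∈ Metric.ball (0 : Fin (m + 1) → ℂ) (1 / (m + 2))) : |rho ζ| ≤ 1 / 2 := by
  have hm : (0 : ℝ) ≤ m := Nat.cast_nonneg m
  rw [mem_ball_zero_iff] at hζ
  set r : ℝ := 1 / (m + 2) with hr
  have hr0 : 0 < r := by positivity
  have hrm : r * (m + 2) = 1 := by rw [hr]; field_simp
  have him : ∀ j, |(ζ j).im| ≤ r := fun j =>
    (Complex.abs_im_le_norm _).trans ((norm_le_pi_norm ζ j).trans hζ.le)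
  have hsum : ∑ k : Fin m, (ζ k.castSucc).im ^ 2 ≤ m * r ^ 2 := by
    calc ∑ k : Fin m, (ζ k.castSucc).im ^ 2 ≤ ∑ _k : Fin m, r ^ 2 :=
          Finset.sum_le_sum fun k _ => sq_le_sq' (abs_le.1 (him _)).1 (abs_le.1 (him _)).2
      _ = m * r ^ 2 := by simp
  have hsum0 : 0 ≤ ∑ k : Fin m, (ζ k.castSucc).im ^ 2 := Finset.sum_nonneg fun k _ => sq_nonneg _
  have hl := abs_le.1 (him (Fin.last m))
  have hr2 : r ≤ 1 / 2 := by nlinarith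
  have hmr : m * r ^ 2 = r * (1 - 2 * r) := by
    rw [← hrm]; ring
  have hq : r + m * r ^ 2 ≤ 1 / 2 := by
    rw [hmr]
    nlinarith [sq_nonneg (2 * r - 1)]
  rw [abs_le]
  constructor <;> unfold rho <;> linarith

theorem mem_tube_of_abs_rho_le {z ζ : Fin (m + 1) → ℂ} (hz : z ∈ tube m)
    (hζ : |rho ζ| ≤ 1 / 2) : phi z ζ ∈ tube m := by
  rw [mem_tube_iff, rho_phi hz]
  exact mul_pos (mem_tube_iff.1 hz) (by linarith [(abs_le.1 hζ).1])

theorem rho_comparable_of_mem_box {z w : Fin (m + 1) → ℂ} (hz : z ∈ tube m)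
    (hw : w ∈ box (1 / (m + 2)) z) : w ∈ tube m ∧ rho z ≤ 2 * rho w ∧ rho w ≤ 2 * rho z := by
  have hρ := mem_tube_iff.1 hz
  rw [← image_phi_ball hz (by positivity)] at hw
  obtain ⟨ζ, hζ, rfl⟩ := hw
  have h := abs_rho_le_of_mem_ball hζ
  refine ⟨mem_tube_of_abs_rho_le hz h, ?_⟩
  rw [rho_phi hz]
  have := abs_le.1 h
  constructor <;> nlinarith

/-- Exchanging the centres changes the last condition by the quadratic error 2 Σ Im(w_k - z_k)(w_k -
z_k), which is of order ρ(z) because |w_k - z_k| is of order √ρ(z). The total is at most (3/2)ρ(z) ≤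
3ρ(w), hence the radius 4. -/
theorem mem_box_symm {z w : Fin (m + 1) → ℂ} (hz : z ∈ tube m)
    (hw : w ∈ box (1 / (m + 2)) z) : z ∈ box 4 w := by
  obtain ⟨hwt, h1, h2⟩ := rho_comparable_of_mem_box hz hw
  have hρ := mem_tube_iff.1 hz
  have hρw := mem_tube_iff.1 hwt
  obtain ⟨hk, hn⟩ := hw
  have hm : (0 : ℝ) ≤ m := Nat.cast_nonneg m
  set r : ℝ := 1 / (m + 2) with hr
  have hr0 : 0 < r := by positivity
  have hrm : r * (m + 2) = 1 := by rw [hr]; field_simp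
  have hr2 : r ≤ 1 / 2 := by nlinarith
  have hs : √(rho z) ≤ 2 * √(rho w) := by
    rw [Real.sqrt_le_left (by positivity), mul_pow, Real.sq_sqrt hρw.le]
    linarith
  have hs0 := Real.sqrt_pos.2 hρ
  refine ⟨fun k => ?_, ?_⟩
  · rw [norm_sub_rev]
    refine (hk k).trans_le ?_
    nlinarith
  · have hd : z (Fin.last m) - w (Fin.last m) -
        2 * ∑ k : Fin m, (w k.castSucc).im * (z k.castSucc - w k.castSucc) =
        -(w (Fin.last m) - z (Fin.last m) -
          2 * ∑ k : Fin m, (z k.castSucc).im * (w k.castSucc - z k.castSucc)) +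
        2 * ∑ k : Fin m, ((w k.castSucc - z k.castSucc).im : ℂ) *
          (w k.castSucc - z k.castSucc) := by
      have : ∑ k : Fin m, ((w k.castSucc).im : ℂ) * (z k.castSucc - w k.castSucc) =
          -∑ k : Fin m, ((z k.castSucc).im : ℂ) * (w k.castSucc - z k.castSucc) -
          ∑ k : Fin m, ((w k.castSucc - z k.castSucc).im : ℂ) * (w k.castSucc - z k.castSucc) := by
        rw [← Finset.sum_neg_distrib, ← Finset.sum_sub_distrib]
        refine Finset.sum_congr rfl fun k _ => ?_
        rw [Complex.sub_im]
        push_cast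
        ring
      rw [this]
      ring
    have hS : ‖∑ k : Fin m, ((w k.castSucc - z k.castSucc).im : ℂ) *
          (w k.castSucc - z k.castSucc)‖ ≤ m * (r ^ 2 * rho z) := by
      calc _ ≤ ∑ _k : Fin m, r ^ 2 * rho z := by
            refine norm_sum_le_of_le _ fun k _ => ?_
            rw [norm_mul, Complex.norm_real, Real.norm_eq_abs]
            have hb := (hk k).le
            calc _ ≤ (r * √(rho z)) * (r * √(rho z)) :=
                  mul_le_mul ((Complex.abs_im_le_norm _).trans hb) hb (norm_nonneg _) (by positivity)
              _ = r ^ 2 * rho z := by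
                  rw [mul_mul_mul_comm, Real.mul_self_sqrt hρ.le]; ring
        _ = m * (r ^ 2 * rho z) := by simp
    have hmr : m * r ^ 2 = r * (1 - 2 * r) := by rw [← hrm]; ring
    rw [hd]
    calc _ ≤ r * rho z + 2 * (m * (r ^ 2 * rho z)) := by
          refine (norm_add_le _ _).trans ?_
          rw [norm_neg, norm_mul, Complex.norm_ofNat]
          linarith [hn.le]
      _ = (r + 2 * (m * r ^ 2)) * rho z := by ring
      _ ≤ 3 / 2 * rho z := by
          rw [hmr]
          gcongr
          nlinarith
      _ < 4 * rho w := by linarith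

theorem rpow_le_of_comparable {a b : ℝ} (ha : 0 < a) (hb : 0 < b) (hab : a ≤ 2 * b)
    (hba : b ≤ 2 * a) (s : ℝ) : a ^ s ≤ 2 ^ |s| * b ^ s := by
  rcases le_total 0 s with hs | hs
  · rw [abs_of_nonneg hs, ← Real.mul_rpow (by norm_num) hb.le]
    exact Real.rpow_le_rpow ha.le hab hs
  · rw [abs_of_nonpos hs]
    have h1 : b ^ s = (b / 2) ^ s * 2 ^ s := by
      rw [← Real.mul_rpow (by positivity) (by norm_num), div_mul_cancel₀ _ two_ne_zero]
    have h2 : (2 : ℝ) ^ (-s) * b ^ s = (b / 2) ^ s := by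
      rw [h1, mul_comm, mul_assoc, ← Real.rpow_add two_pos, add_neg_cancel, Real.rpow_zero, mul_one]
    rw [h2]
    exact Real.rpow_le_rpow_of_nonpos (by positivity) (by linarith) hs

theorem measurable_ofReal_rho_rpow (s : ℝ) :
    Measurable fun z : Fin (m + 1) → ℂ => ENNReal.ofReal (rho z ^ s) :=
  (continuous_rho.measurable.pow_const s).ennreal_ofReal

/-- The factor ρ(z)^{m+2} of ρ(z)^t is spent on the Jacobian of φ_z. The remaining power is moved
from `z` to `w` by comparability, leaving `z` only in the indicator of a box at `w`. -/
theorem lintegral_ball_phi_mul_le {z : Fin (m + 1) → ℂ} (hz : z ∈ tube m) (t : ℝ)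
    {g : (Fin (m + 1) → ℂ) → ℝ≥0∞} (hg : Measurable g) :
    (∫⁻ ζ in Metric.ball 0 (1 / (m + 2)), g (phi z ζ)) * ENNReal.ofReal (rho z ^ t) ≤
      ∫⁻ w, (tube m).indicator (fun w => ENNReal.ofReal (2 ^ |t - (m + 2 : ℕ)|) *
        (g w * ENNReal.ofReal (rho w ^ (t - (m + 2 : ℕ))))) w *
          (box 4 w).indicator 1 z := by
  have hρ := mem_tube_iff.1 hz
  have hR : (0 : ℝ) < 1 / (m + 2) := by positivity
  set s : ℝ := t - (m + 2 : ℕ) with hs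
  have h1 : ENNReal.ofReal (rho z ^ t) =
      ENNReal.ofReal (rho z ^ (m + 2)) * ENNReal.ofReal (rho z ^ s) := by
    rw [← ENNReal.ofReal_mul (by positivity), ← Real.rpow_natCast, ← Real.rpow_add hρ, hs]
    congr 2
    ring
  have hbox : MeasurableSet (box (1 / (m + 2)) z) :=
    measurable_prodMk_right (measurableSet_box_graph (m := m) (1 / (m + 2)))
  rw [h1, mul_left_comm, mul_comm _ (ENNReal.ofReal (rho z ^ s)), mul_left_comm,
    ← lintegral_image_phi hz measurableSet_ball, image_phi_ball hz hR,
    ← lintegral_const_mul _ hg, ← lintegral_indicator hbox]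
  refine lintegral_mono fun w => ?_
  by_cases hw : w ∈ box (1 / (m + 2)) z
  · obtain ⟨hwt, h2, h3⟩ := rho_comparable_of_mem_box hz hw
    have hc := ENNReal.ofReal_le_ofReal
      (rpow_le_of_comparable hρ (mem_tube_iff.1 hwt) h2 h3 s)
    rw [ENNReal.ofReal_mul (by positivity)] at hc
    rw [Set.indicator_of_mem hw, Set.indicator_of_mem hwt, Set.indicator_of_mem (mem_box_symm hz hw),
      Pi.one_apply, mul_one]
    calc _ ≤ _ := mul_le_mul_left hc (g w)
      _ = _ := by ring
  · rw [Set.indicator_of_notMem hw]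
    exact zero_le

/-- After Tonelli the `z`-integral is the volume of `box 4 w`, which restores the factor ρ(w)^{m+2}
removed by the change of variables. -/
theorem lintegral_tube_lintegral_ball_le (t : ℝ) {g : (Fin (m + 1) → ℂ) → ℝ≥0∞}
    (hg : Measurable g) :
    ∫⁻ z in tube m, (∫⁻ ζ in Metric.ball 0 (1 / (m + 2)), g (phi z ζ)) *
        ENNReal.ofReal (rho z ^ t) ≤
      (ENNReal.ofReal (2 ^ |t - (m + 2 : ℕ)|) * volume (Metric.ball (0 : Fin (m + 1) → ℂ) 4)) *
        ∫⁻ w in tube m, g w * ENNReal.ofReal (rho w ^ t) := by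
  set s : ℝ := t - (m + 2 : ℕ) with hs
  set G : (Fin (m + 1) → ℂ) → ℝ≥0∞ := (tube m).indicator (fun w => ENNReal.ofReal (2 ^ |s|) *
        (g w * ENNReal.ofReal (rho w ^ s))) with hG
  have hGm : Measurable G :=
    ((hg.mul (measurable_ofReal_rho_rpow s)).const_mul _).indicator isOpen_tube.measurableSet
  have hbm : Measurable fun p : (Fin (m + 1) → ℂ) × (Fin (m + 1) → ℂ) =>
      (box 4 p.2).indicator (1 : (Fin (m + 1) → ℂ) → ℝ≥0∞) p.1 :=
    measurable_one.indicator (measurableSet_box_graph (m := m) 4)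
  calc _ ≤ ∫⁻ z in tube m, ∫⁻ w, G w * (box 4 w).indicator 1 z :=
        setLIntegral_mono' isOpen_tube.measurableSet fun z hz => lintegral_ball_phi_mul_le hz t hg
    _ ≤ ∫⁻ z, ∫⁻ w, G w * (box 4 w).indicator 1 z := setLIntegral_le_lintegral _ _
    _ = ∫⁻ w, ∫⁻ z, G w * (box 4 w).indicator 1 z :=
        lintegral_lintegral_swap ((hGm.comp measurable_snd).mul hbm).aemeasurable
    _ = ∫⁻ w, G w * volume (box 4 w) := by
        refine lintegral_congr fun w => ?_
        have hb : MeasurableSet (box 4 w) :=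
          measurable_prodMk_right (measurableSet_box_graph (m := m) 4)
        rw [lintegral_const_mul _ (measurable_one.indicator hb), lintegral_indicator_one hb]
    _ = ∫⁻ w in tube m, (ENNReal.ofReal (2 ^ |s|) *
          volume (Metric.ball (0 : Fin (m + 1) → ℂ) 4)) * (g w * ENNReal.ofReal (rho w ^ t)) := by
        rw [← lintegral_indicator isOpen_tube.measurableSet]
        refine lintegral_congr fun w => ?_
        by_cases hw : w ∈ tube m
        · have hρ := mem_tube_iff.1 hw
          have h1 : ENNReal.ofReal (rho w ^ t) =
              ENNReal.ofReal (rho w ^ (m + 2)) * ENNReal.ofReal (rho w ^ s) := by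
            rw [← ENNReal.ofReal_mul (by positivity), ← Real.rpow_natCast, ← Real.rpow_add hρ, hs]
            congr 2
            ring
          rw [hG, Set.indicator_of_mem hw, Set.indicator_of_mem hw, volume_box hw (by norm_num), h1]
          ring
        · rw [hG, Set.indicator_of_notMem hw, Set.indicator_of_notMem hw, zero_mul]
    _ = _ := lintegral_const_mul _ (hg.mul (measurable_ofReal_rho_rpow t))

theorem measurable_indicator_of_continuousOn {f : (Fin (m + 1) → ℂ) → ℂ}
    {U : Set (Fin (m + 1) → ℂ)} (hU : IsOpen U) (hf : ContinuousOn f U) :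
    Measurable (U.indicator f) := by
  classical
  rw [← Set.piecewise_eq_indicator]
  exact hf.measurable_piecewise continuousOn_const hU.measurableSet

theorem exists_lintegral_foldr_opL_le (l : List (Fin (m + 1))) {q : ℝ} (hq : 1 ≤ q) (t : ℝ) :
    ∃ K : ℝ≥0∞, K ≠ ⊤ ∧ ∀ f : (Fin (m + 1) → ℂ) → ℂ, DifferentiableOn ℂ f (tube m) →
      ∫⁻ z in tube m, ‖((rho z ^ (l.map opWeight).sum : ℝ) : ℂ) * l.foldr opL f z‖ₑ ^ q *
          ENNReal.ofReal (rho z ^ t) ≤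
        K * ∫⁻ z in tube m, ‖f z‖ₑ ^ q * ENNReal.ofReal (rho z ^ t) := by
  have hq0 : 0 < q := by linarith
  have hm : (0 : ℝ) ≤ m := Nat.cast_nonneg m
  obtain ⟨C, hCt, hC⟩ := exists_enorm_foldr_opL_zero_le (m := m) (R := 1 / (m + 2))
    (by positivity) (by rw [div_le_one (by positivity)]; linarith) l hq
  refine ⟨C * (ENNReal.ofReal (2 ^ |t - (m + 2 : ℕ)|) *
    volume (Metric.ball (0 : Fin (m + 1) → ℂ) 4)), ENNReal.mul_ne_top hCt
      (ENNReal.mul_ne_top ENNReal.ofReal_ne_top measure_ball_lt_top.ne), fun f hf => ?_⟩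
  -- Nothing is known of `f` off the tube, so it is cut off to obtain a measurable function.
  set g : (Fin (m + 1) → ℂ) → ℝ≥0∞ := fun z => ‖(tube m).indicator f z‖ₑ ^ q with hg_def
  have hg : Measurable g :=
    (measurable_indicator_of_continuousOn isOpen_tube hf.continuousOn).enorm.pow_const q
  have hgf : ∀ z ∈ tube m, g z = ‖f z‖ₑ ^ q := fun z hz => by
    simp only [hg_def, Set.indicator_of_mem hz]
  have hmaps : ∀ z ∈ tube m, Set.MapsTo (phi z) (Metric.ball 0 (1 / (m + 2))) (tube m) :=
    fun z hz ζ hζ => mem_tube_of_abs_rho_le hz (abs_rho_le_of_mem_ball hζ)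
  calc _ ≤ ∫⁻ z in tube m, C * ((∫⁻ ζ in Metric.ball 0 (1 / (m + 2)), g (phi z ζ)) *
        ENNReal.ofReal (rho z ^ t)) := by
        refine setLIntegral_mono' isOpen_tube.measurableSet fun z hz => ?_
        have h1 := foldr_opL_comp_phi hz (contDiffOn_real_of_differentiableOn isOpen_tube hf) l
          (x := 0) (by rwa [Set.mem_preimage, phi_zero])
        simp only [phi_zero] at h1
        rw [← h1, ← mul_assoc]
        refine mul_le_mul_left ?_ _
        have h2 := hC (fun ζ => f (phi z ζ)) (hf.comp
          (fun ζ _ => (hasFDerivAt_phi z ζ).differentiableAt.differentiableWithinAt) (hmaps z hz))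
        refine h2.trans (le_of_eq ?_)
        congr 1
        exact setLIntegral_congr_fun measurableSet_ball fun ζ hζ => (hgf _ (hmaps z hz hζ)).symm
    _ = C * ∫⁻ z in tube m, (∫⁻ ζ in Metric.ball 0 (1 / (m + 2)), g (phi z ζ)) *
        ENNReal.ofReal (rho z ^ t) := lintegral_const_mul' _ _ hCt
    _ ≤ C * ((ENNReal.ofReal (2 ^ |t - (m + 2 : ℕ)|) *
        volume (Metric.ball (0 : Fin (m + 1) → ℂ) 4)) *
          ∫⁻ w in tube m, g w * ENNReal.ofReal (rho w ^ t)) :=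
        mul_le_mul_right (lintegral_tube_lintegral_ball_le t hg) C
    _ = _ := by
        rw [← mul_assoc]
        congr 1
        exact setLIntegral_congr_fun isOpen_tube.measurableSet fun z hz => by
          simp only [hgf z hz]

end Estimate

/-! ### From the estimate to bounded operators -/

section Bergman

variable {m : ℕ}

theorem ae_weightedVolume_of_eqOn {t : ℝ} {f g : (Fin (m + 1) → ℂ) → ℂ}
    (h : Set.EqOn f g (tube m)) : f =ᵐ[weightedVolume m t] g :=
  (withDensity_absolutelyContinuous _ _).ae_eq
    ((ae_restrict_mem isOpen_tube.measurableSet).mono h)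

/-- The density ρ^t is positive on the tube, so the weighted measure has the same null sets there as
Lebesgue measure. This makes the holomorphic representative of a class unique on the tube. -/
theorem eqOn_of_ae_weightedVolume {t : ℝ} {f g : (Fin (m + 1) → ℂ) → ℂ}
    (hf : ContinuousOn f (tube m)) (hg : ContinuousOn g (tube m))
    (h : f =ᵐ[weightedVolume m t] g) : Set.EqOn f g (tube m) := by
  refine Measure.eqOn_open_of_ae_eq (μ := volume) ?_ isOpen_tube hf hg
  have h1 := (ae_withDensity_iff (measurable_ofReal_rho_rpow t)).1 h
  filter_upwards [h1, ae_restrict_mem isOpen_tube.measurableSet] with z hz hzt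
  exact hz (ENNReal.ofReal_pos.2 (Real.rpow_pos_of_pos (mem_tube_iff.1 hzt) t)).ne'

theorem lintegral_weightedVolume (t : ℝ) (g : (Fin (m + 1) → ℂ) → ℝ≥0∞) :
    ∫⁻ z, g z ∂weightedVolume m t = ∫⁻ z in tube m, g z * ENNReal.ofReal (rho z ^ t) := by
  rw [weightedVolume, lintegral_withDensity_eq_lintegral_mul_non_measurable _
    (measurable_ofReal_rho_rpow t) (Filter.Eventually.of_forall fun _ => ENNReal.ofReal_lt_top)]
  exact lintegral_congr fun z => mul_comm _ _

/-- The operator is applied to a chosen holomorphic representative. Uniqueness of representatives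
gives both linearity and independence of the choice. -/
theorem exists_clm_of_lintegral_le {p : ℝ≥0∞} [Fact (1 ≤ p)] (hp : p ≠ ∞) (t t' : ℝ)
    (A : ((Fin (m + 1) → ℂ) → ℂ) → (Fin (m + 1) → ℂ) → ℂ)
    (hcongr : ∀ f g, Set.EqOn f g (tube m) → Set.EqOn (A f) (A g) (tube m))
    (hadd : ∀ f g, DifferentiableOn ℂ f (tube m) → DifferentiableOn ℂ g (tube m) →
      Set.EqOn (A (f + g)) (A f + A g) (tube m))
    (hsmul : ∀ (c : ℂ) f, DifferentiableOn ℂ f (tube m) →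
      Set.EqOn (A (c • f)) (c • A f) (tube m))
    (hcont : ∀ f, DifferentiableOn ℂ f (tube m) → ContinuousOn (A f) (tube m))
    {K : ℝ≥0∞} (hK : K ≠ ⊤) (hbound : ∀ f, DifferentiableOn ℂ f (tube m) →
      ∫⁻ z in tube m, ‖A f z‖ₑ ^ p.toReal * ENNReal.ofReal (rho z ^ t') ≤
        K * ∫⁻ z in tube m, ‖f z‖ₑ ^ p.toReal * ENNReal.ofReal (rho z ^ t)) :
    ∃ T : bergman m p t →L[ℂ] WeightedLp m p t',
      ∀ (f : bergman m p t) (F : (Fin (m + 1) → ℂ) → ℂ), DifferentiableOn ℂ F (tube m) →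
        (f : WeightedLp m p t) =ᵐ[weightedVolume m t] F →
        T f =ᵐ[weightedVolume m t'] A F := by
  have hp1 : 1 ≤ p := Fact.out
  have hp0 : p ≠ 0 := (zero_lt_one.trans_le hp1).ne'
  have hq0 : 0 < p.toReal := ENNReal.toReal_pos hp0 hp
  choose F hF hfF using fun f : bergman m p t => f.2
  have hnorm : ∀ f, DifferentiableOn ℂ f (tube m) →
      eLpNorm (A f) p (weightedVolume m t') ≤
        K ^ (1 / p.toReal) * eLpNorm f p (weightedVolume m t) := by
    intro f hf
    rw [eLpNorm_eq_lintegral_rpow_enorm_toReal hp0 hp, eLpNorm_eq_lintegral_rpow_enorm_toReal hp0 hp,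
      ← ENNReal.mul_rpow_of_nonneg _ _ (by positivity), lintegral_weightedVolume,
      lintegral_weightedVolume]
    exact ENNReal.rpow_le_rpow (hbound f hf) (by positivity)
  have hKt : K ^ (1 / p.toReal) ≠ ⊤ := ENNReal.rpow_ne_top_of_nonneg (by positivity) hK
  have hle : ∀ f : bergman m p t, eLpNorm (A (F f)) p (weightedVolume m t') ≤
      K ^ (1 / p.toReal) * eLpNorm (f : WeightedLp m p t) p (weightedVolume m t) := by
    intro f
    rw [eLpNorm_congr_ae (hfF f)]
    exact hnorm _ (hF f)
  have hmem : ∀ f : bergman m p t, MemLp (A (F f)) p (weightedVolume m t') := by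
    intro f
    refine ⟨?_, (hle f).trans_lt (ENNReal.mul_lt_top hKt.lt_top (Lp.memLp (f : WeightedLp m p t)).2)⟩
    exact ((hcont _ (hF f)).aestronglyMeasurable isOpen_tube.measurableSet).mono_ac
      (withDensity_absolutelyContinuous _ _)
  have hrep : ∀ (f : bergman m p t) (G : (Fin (m + 1) → ℂ) → ℂ), DifferentiableOn ℂ G (tube m) →
      (f : WeightedLp m p t) =ᵐ[weightedVolume m t] G →
      (hmem f).toLp =ᵐ[weightedVolume m t'] A G := by
    intro f G hG hfG
    refine (hmem f).coeFn_toLp.trans (ae_weightedVolume_of_eqOn (hcongr _ _ ?_))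
    exact eqOn_of_ae_weightedVolume (hF f).continuousOn hG.continuousOn ((hfF f).symm.trans hfG)
  let T₀ : bergman m p t →ₗ[ℂ] WeightedLp m p t' :=
    { toFun := fun f => (hmem f).toLp
      map_add' := by
        intro f g
        refine Lp.ext ?_
        refine (hrep (f + g) (F f + F g) ((hF f).add (hF g)) ?_).trans ?_
        · exact (Lp.coeFn_add _ _).trans ((hfF f).add (hfF g))
        · refine (ae_weightedVolume_of_eqOn (hadd _ _ (hF f) (hF g))).trans ?_
          exact (((hmem f).coeFn_toLp.add (hmem g).coeFn_toLp).symm).trans (Lp.coeFn_add _ _).symm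
      map_smul' := by
        intro c f
        refine Lp.ext ?_
        refine (hrep (c • f) (c • F f) ((hF f).const_smul c) ?_).trans ?_
        · exact (Lp.coeFn_smul _ _).trans ((hfF f).const_smul c)
        · refine (ae_weightedVolume_of_eqOn (hsmul c _ (hF f))).trans ?_
          exact ((hmem f).coeFn_toLp.const_smul c).symm.trans (Lp.coeFn_smul _ _).symm }
  refine ⟨T₀.mkContinuous (K ^ (1 / p.toReal)).toReal fun f => ?_, hrep⟩
  have h1 : ‖T₀ f‖ = (eLpNorm (A (F f)) p (weightedVolume m t')).toReal := Lp.norm_toLp _ (hmem f)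
  have h2 : ‖f‖ = (eLpNorm (f : WeightedLp m p t) p (weightedVolume m t)).toReal := Lp.norm_def _
  rw [h1, h2, ← ENNReal.toReal_mul]
  exact ENNReal.toReal_mono (ENNReal.mul_ne_top hKt (Lp.memLp (f : WeightedLp m p t)).2.ne) (hle f)

theorem continuousOn_rho_rpow_mul {f : (Fin (m + 1) → ℂ) → ℂ} (hf : ContinuousOn f (tube m))
    (s : ℝ) : ContinuousOn (fun z => ((rho z ^ s : ℝ) : ℂ) * f z) (tube m) := by
  refine ContinuousOn.mul ?_ hf
  refine Complex.continuous_ofReal.comp_continuousOn ?_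
  exact continuous_rho.continuousOn.rpow_const fun z hz => Or.inl (mem_tube_iff.1 hz).ne'

/-- The weight ρ^σ, with σ the total homogeneity of the word, may be shared between function and
measure: a factor ρ^s stays on the function, and the remaining ρ^{σ-s} enters the measure as
ρ^{(σ-s)p}. -/
theorem exists_clm_foldr_opL {p : ℝ≥0∞} [Fact (1 ≤ p)] (hp : p ≠ ∞) (t s : ℝ)
    (l : List (Fin (m + 1))) :
    ∃ T : bergman m p t →L[ℂ] WeightedLp m p (t + ((l.map opWeight).sum - s) * p.toReal),
      ∀ (f : bergman m p t) (F : (Fin (m + 1) → ℂ) → ℂ), DifferentiableOn ℂ F (tube m) →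
        (f : WeightedLp m p t) =ᵐ[weightedVolume m t] F →
        T f =ᵐ[weightedVolume m (t + ((l.map opWeight).sum - s) * p.toReal)]
          fun z => ((rho z ^ s : ℝ) : ℂ) * l.foldr opL F z := by
  have hq : 1 ≤ p.toReal := by
    have hp1 : 1 ≤ p := Fact.out
    simpa using ENNReal.toReal_mono hp hp1
  obtain ⟨K, hK, hbound⟩ := exists_lintegral_foldr_opL_le (m := m) l hq t
  refine exists_clm_of_lintegral_le hp t _ (fun F z => ((rho z ^ s : ℝ) : ℂ) * l.foldr opL F z)
    ?_ ?_ ?_ ?_ hK ?_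
  · intro f g hfg z hz
    simp only [foldr_opL_congr_on isOpen_tube hfg l hz]
  · intro f g hf hg z hz
    simp only [foldr_opL_add isOpen_tube (contDiffOn_real_of_differentiableOn isOpen_tube hf)
      (contDiffOn_real_of_differentiableOn isOpen_tube hg) l hz, Pi.add_apply]
    ring
  · intro c f hf z hz
    simp only [foldr_opL_smul isOpen_tube c (contDiffOn_real_of_differentiableOn isOpen_tube hf)
      l hz, Pi.smul_apply, smul_eq_mul]
    ring
  · intro f hf
    exact continuousOn_rho_rpow_mul (contDiffOn_foldr_opL isOpen_tube
      (contDiffOn_real_of_differentiableOn isOpen_tube hf) l).continuousOn s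
  · intro f hf
    refine le_trans (le_of_eq ?_) (hbound f hf)
    refine setLIntegral_congr_fun isOpen_tube.measurableSet fun z hz => ?_
    have hρ := mem_tube_iff.1 hz
    have h : ∀ a b : ℝ, ‖((rho z ^ a : ℝ) : ℂ) * l.foldr opL f z‖ₑ ^ p.toReal *
        ENNReal.ofReal (rho z ^ b) =
          ENNReal.ofReal (rho z ^ (a * p.toReal + b)) * ‖l.foldr opL f z‖ₑ ^ p.toReal := by
      intro a b
      rw [enorm_mul, ENNReal.mul_rpow_of_nonneg _ _ (by linarith), ← ofReal_norm ((_ : ℝ) : ℂ),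
        Complex.norm_real, Real.norm_eq_abs, abs_of_pos (Real.rpow_pos_of_pos hρ a),
        ENNReal.ofReal_rpow_of_pos (Real.rpow_pos_of_pos hρ a), ← Real.rpow_mul hρ.le,
        Real.rpow_add hρ, ENNReal.ofReal_mul (by positivity), mul_right_comm]
    simp only [h]
    congr 3
    ring

theorem mem_bergman {p : ℝ≥0∞} [Fact (1 ≤ p)] {t : ℝ} {f : WeightedLp m p t}
    {F : (Fin (m + 1) → ℂ) → ℂ} (hF : DifferentiableOn ℂ F (tube m))
    (hf : f =ᵐ[weightedVolume m t] F) : f ∈ bergman m p t :=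
  ⟨F, hF, hf⟩

/-- Unlike the other `L_j`, `L_n` has constant coefficients; on holomorphic functions it is a
complex directional derivative, so it preserves holomorphy. -/
theorem differentiableOn_opL_last {f : (Fin (m + 1) → ℂ) → ℂ} (hf : DifferentiableOn ℂ f (tube m)) :
    DifferentiableOn ℂ (opL (Fin.last m) f) (tube m) := by
  refine (differentiableOn_fderiv_apply isOpen_tube hf (Pi.single (Fin.last m) 1)).congr ?_
  intro z hz
  have hd := hf.differentiableAt (isOpen_tube.mem_nhds hz)
  have h1 : ∀ v, fderiv ℝ f z v = fderiv ℂ f z v := fun v => by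
    rw [hd.fderiv_restrictScalars ℝ]; rfl
  have h2 : (Pi.single (Fin.last m) Complex.I : Fin (m + 1) → ℂ) =
      Complex.I • Pi.single (Fin.last m) 1 := by
    rw [← Pi.single_smul, smul_eq_mul, mul_one]
  rw [opL_last, wirtinger, h1, h1, h2, map_smul, smul_eq_mul]
  linear_combination -(1 / 2) * fderiv ℂ f z (Pi.single (Fin.last m) 1) * Complex.I_sq

theorem differentiableOn_iterate_opL_last {f : (Fin (m + 1) → ℂ) → ℂ}
    (hf : DifferentiableOn ℂ f (tube m)) (N : ℕ) :
    DifferentiableOn ℂ ((opL (Fin.last m))^[N] f) (tube m) := by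
  induction N with
  | zero => exact hf
  | succ N ih =>
    rw [Function.iterate_succ_apply']
    exact differentiableOn_opL_last ih

end Bergman

end TubeDomain

end

theorem mainTheorem5 (m : ℕ) (p : ℝ≥0∞) [Fact (1 ≤ p)] (hp : p ≠ ∞) (t : ℝ) (ht : -1 < t) :
    (∀ γ : Fin (m + 1) → ℕ,
      ∃ T : TubeDomain.bergman m p t →L[ℂ] TubeDomain.WeightedLp m p t,
        ∀ (f : TubeDomain.bergman m p t) (F : (Fin (m + 1) → ℂ) → ℂ),
          DifferentiableOn ℂ F (TubeDomain.tube m) →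
          (f : TubeDomain.WeightedLp m p t) =ᵐ[TubeDomain.weightedVolume m t] F →
          T f =ᵐ[TubeDomain.weightedVolume m t] fun z =>
            ((TubeDomain.rho z ^ TubeDomain.bracket γ : ℝ) : ℂ) * TubeDomain.opLPow γ F z) ∧
    (∀ N : ℕ,
      ∃ S : TubeDomain.bergman m p t →L[ℂ] TubeDomain.bergman m p (t + N * p.toReal),
        ∀ (f : TubeDomain.bergman m p t) (F : (Fin (m + 1) → ℂ) → ℂ),
          DifferentiableOn ℂ F (TubeDomain.tube m) →
          (f : TubeDomain.WeightedLp m p t) =ᵐ[TubeDomain.weightedVolume m t] F →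
          (S f : TubeDomain.WeightedLp m p (t + N * p.toReal))
            =ᵐ[TubeDomain.weightedVolume m (t + N * p.toReal)]
              (TubeDomain.opL (Fin.last m))^[N] F) := by
  refine ⟨fun γ => ?_, fun N => ?_⟩
  -- The whole weight stays on the function, so the measure is unchanged.
  · have h := TubeDomain.exists_clm_foldr_opL (m := m) hp t (TubeDomain.bracket γ)
      (TubeDomain.indexList γ)
    rw [TubeDomain.sum_opWeight_indexList, sub_self, zero_mul, add_zero] at h
    simpa only [← TubeDomain.opLPow_eq_foldr] using h
  -- With `s = 0` the whole weight goes into the measure; the image is again holomorphic, so the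
  -- codomain can be restricted.
  · have h := TubeDomain.exists_clm_foldr_opL (m := m) hp t 0 (List.replicate N (Fin.last m))
    have hw : ((List.replicate N (Fin.last m)).map TubeDomain.opWeight).sum = N := by
      simp [TubeDomain.opWeight]
    rw [hw, sub_zero] at h
    simp only [TubeDomain.foldr_opL_replicate, Real.rpow_zero, Complex.ofReal_one,
      one_mul] at h
    obtain ⟨T, hT⟩ := h
    have hmem : ∀ f, T f ∈ TubeDomain.bergman m p (t + N * p.toReal) := fun f => by
      obtain ⟨F, hF, hfF⟩ := f.2
      exact TubeDomain.mem_bergman (TubeDomain.differentiableOn_iterate_opL_last hF N)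
        (hT f F hF hfF)
    exact ⟨T.codRestrict (TubeDomain.bergman m p (t + N * p.toReal)) hmem, hT⟩
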